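/- Let $\mathcal A$ be a complete Abelian category with enough injectives which is (Ab.$4^*$)-$k$ for some $k\in\mathbb N$, that is, for every family $(A_\lambda)_{\lambda\in\Lambda}$ of objects of $\mathcal A$ (indexed by a set), the right derived functors $\prod^{(n)}_{\Lambda}A_\lambda$ of the product functor $\prod_\Lambda\colon\mathcal A^\Lambda\to\mathcal A$ vanish for all $n>k$. Let $A^\bullet$ be a (possibly unbounded) cochain complex over $\mathcal A$ and let $\lambda^\bullet\colon A^\bullet\to C^{0,\bullet}$ be an injective Cartan–Eilenberg resolution of $A^\bullet$. Then the morphism $A^\bullet\to\mathrm{Tot}(C^{\bullet,\bullet})$ induced by $\lambda^\bullet$ is a dg-injective resolution of $A^\bullet$; that is, it is a quasi-isomorphism, each $\mathrm{Tot}(C^{\bullet,\bullet})^n$ is injective, and the total hom-complex $\underline{\mathrm{Hom}}(X^\bullet,\mathrm{Tot}(C^{\bullet,\bullet}))$ is exact for every exact complex $X^\bullet$ over $\mathcal A$. Here a bicomplex $C^{\bullet,\bullet}$ has differentials $d_0\colon C^{n,m}\to C^{n,m+1}$ and $d_1\colon C^{n,m}\to C^{n+1,m}$ with $d_0d_0=0$,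 $d_1d_1=0$ and $d_0d_1+d_1d_0=0$, and $\mathrm{Tot}(C^{\bullet,\bullet})$ is its totalization through products: $\mathrm{Tot}(C^{\bullet,\bullet})^n=\prod_{i\in\mathbb Z}C^{i,n-i}$, with differential $d_0+d_1$. Let $C_0$ be the double complex whose $m$-th column is $C^{\bullet,m}$ with differential $(-1)^md_1$, and whose horizontal differentials are those given by $d_0$; its coboundaries $B^n(C_0)$ and cohomology $H^n(C_0)$ in the horizontal direction are cochain complexes over $\mathcal A$. An injective Cartan–Eilenberg resolution of $A^\bullet$ is a bicomplex $C^{\bullet,\bullet}$ of injective objects with $C^{n,m}=0$ for $n<0$, together with a morphism of complexes $\lambda^\bullet\colon A^\bullet\to C^{0,\bullet}$ with $d_1\circ\lambda^\bullet=0$, such that (1) if $A^m=0$ then $C^{n,m}=0$ for all $n$; and, for all $n\in\mathbb Z$, the maps induced by $\lambda^\bullet$ make (2) $B^n(A^\bullet)\to B^n(C_0)$ an injective resolution of $B^n(A^\bullet)$, and (3) $H^n(A^\bullet)\to H^n(C_0)$ an injective resolution of $H^n(A^\bullet)$. -/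

import Mathlib

open CategoryTheory CategoryTheory.Limits

universe v u

noncomputable section

namespace CartanEilenberg

variable {C : Type u} [Category.{v} C] [Abelian C]

/-! ### Derived functors of products and the condition (Ab.4*)-k -/

/-- A family of injective objects, indexed by a discrete category, is injective. -/
theorem injective_of_forall {ι : Type v} (J : Discrete ι ⥤ C)
    (hJ : ∀ j, Injective (J.obj j)) : Injective J where
  factors {X Y} g f hf := by
    have hm : ∀ j, Mono (f.app j) := fun j => inferInstance
    refine ⟨⟨fun j => Injective.factorThru (J := J.obj j) (g.app j) (f.app j), ?_⟩, ?_⟩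
    · rintro ⟨i⟩ ⟨j⟩ φ
      obtain rfl : i = j := Discrete.eq_of_hom φ
      obtain rfl : φ = 𝟙 _ := Subsingleton.elim _ _
      simp
    · ext j
      simp

/-- If `C` has enough injectives, then so does the category of families of objects of `C`. -/
instance enoughInjectives_families {ι : Type v} [EnoughInjectives C] :
    EnoughInjectives (Discrete ι ⥤ C) where
  presentation F := by
    let f : F ⟶ Discrete.functor (fun i : ι => Injective.under (F.obj ⟨i⟩)) :=
      Discrete.natTrans (fun i => Injective.ι (F.obj ⟨i.as⟩))
    have hf : ∀ j, Mono (f.app j) := by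
      rintro ⟨i⟩
      dsimp [f]
      infer_instance
    exact ⟨{  J := Discrete.functor (fun i : ι => Injective.under (F.obj ⟨i⟩))
              injective := injective_of_forall _ (fun j => by dsimp; infer_instance)
              f := f
              mono := NatTrans.mono_of_mono_app f }⟩

variable (C) in
/-- The product functor, sending a family `(A_i)_i` of objects of `C` to `∏ A_i`. -/
abbrev prodFunctor [HasLimits C] (ι : Type v) : (Discrete ι ⥤ C) ⥤ C := lim

instance [HasLimits C] (ι : Type v) : (prodFunctor C ι).Additive where
  map_add {X Y f g} := by
    apply limit.hom_ext
    intro j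
    simp [prodFunctor]

variable (C) in
/-- Roos' condition (Ab.4*)-`k`: the right derived functors `∏^(n)` of the products, indexed by
arbitrary (small) sets, vanish for all `n > k`. -/
def AbFourStar [HasLimits C] [EnoughInjectives C] (k : ℕ) : Prop :=
  ∀ (ι : Type v) (A : ι → C) (n : ℕ), k < n →
    IsZero (((prodFunctor C ι).rightDerived n).obj (Discrete.functor A))

/-! ### Resolutions -/

/-- A morphism `S^0(B) ⟶ I` from the stalk complex of `B` in degree `0` is an
injective resolution of `B`. -/
structure IsInjectiveResolution {B : C} {I : CochainComplex C ℤ}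
    (f : (HomologicalComplex.single C (ComplexShape.up ℤ) 0).obj B ⟶ I) : Prop where
  injective : ∀ n, Injective (I.X n)
  isZero : ∀ n < 0, IsZero (I.X n)
  quasiIso : QuasiIso f

/-- The dg-injective complexes: degreewise injective complexes `E` such that the total
hom-complex `Hom(X, E)` is exact for all exact complexes `X`. -/
structure IsDGInjective (E : CochainComplex C ℤ) : Prop where
  injective : ∀ n, Injective (E.X n)
  acyclic_homComplex : ∀ X : CochainComplex C ℤ, X.Acyclic →
    (CochainComplex.HomComplex X E).Acyclic

/-- A dg-injective resolution of `A`: a quasi-isomorphism to a dg-injective complex. -/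
structure IsDGInjectiveResolution {A E : CochainComplex C ℤ} (f : A ⟶ E) : Prop where
  quasiIso : QuasiIso f
  isDGInjective : IsDGInjective E

/-! ### Bicomplexes -/

variable (C) in
/-- A bicomplex, with horizontal differentials `d₀ : X n m ⟶ X n (m + 1)` and vertical
differentials `d₁ : X n m ⟶ X (n + 1) m`, whose squares anticommute. Following the convention of
`HomologicalComplex`, the differentials are given between any two objects of a row (or column)
and they vanish unless these are consecutive. -/
structure Bicomplex where
  X : ℤ → ℤ → C
  d₀ : ∀ n m m', X n m ⟶ X n m'
  d₁ : ∀ n n' m, X n m ⟶ X n' m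
  shape₀ : ∀ n m m', m + 1 ≠ m' → d₀ n m m' = 0
  shape₁ : ∀ n n' m, n + 1 ≠ n' → d₁ n n' m = 0
  d₀_comp_d₀ : ∀ n m m' m'', d₀ n m m' ≫ d₀ n m' m'' = 0
  d₁_comp_d₁ : ∀ n n' n'' m, d₁ n n' m ≫ d₁ n' n'' m = 0
  anticomm : ∀ n n' m m', d₀ n m m' ≫ d₁ n n' m' + d₁ n n' m ≫ d₀ n' m m' = 0

namespace Bicomplex

variable (K : Bicomplex C)

/-- The `n`-th row of a bicomplex. -/
abbrev row (n : ℤ) : CochainComplex C ℤ where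
  X m := K.X n m
  d m m' := K.d₀ n m m'
  shape m m' h := K.shape₀ n m m' h
  d_comp_d' m m' m'' _ _ := K.d₀_comp_d₀ n m m' m''

/-- The `m`-th column of a bicomplex, with differential `(-1)^m d₁`. -/
abbrev column (m : ℤ) : CochainComplex C ℤ where
  X n := K.X n m
  d n n' := m.negOnePow • K.d₁ n n' m
  shape n n' h := by rw [K.shape₁ n n' m h, smul_zero]
  d_comp_d' n n' n'' _ _ := by
    rw [Linear.units_smul_comp, Linear.comp_units_smul, K.d₁_comp_d₁, smul_zero, smul_zero]

/-- The double complex `C₀ ∈ Ch(Ch(C))` of a bicomplex, with commuting squares: the complex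
of the columns `(-1)^m d₁`, with differentials induced by `d₀`. -/
abbrev toDouble : CochainComplex (CochainComplex C ℤ) ℤ where
  X m := K.column m
  d m m' :=
    { f := fun n => K.d₀ n m m'
      comm' := fun n n' _ => by
        by_cases h : m + 1 = m'
        · subst h
          have := K.anticomm n n' m (m + 1)
          rw [← eq_neg_iff_add_eq_zero] at this
          change K.d₀ n m (m + 1) ≫ ((m + 1).negOnePow • K.d₁ n n' (m + 1)) =
            (m.negOnePow • K.d₁ n n' m) ≫ K.d₀ n' m (m + 1)
          rw [Linear.units_smul_comp, Linear.comp_units_smul, this, Int.negOnePow_succ,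
            Units.neg_smul, smul_neg, neg_neg]
        · change K.d₀ n m m' ≫ (m'.negOnePow • K.d₁ n n' m') =
            (m.negOnePow • K.d₁ n n' m) ≫ K.d₀ n' m m'
          rw [K.shape₀ n m m' h, K.shape₀ n' m m' h, zero_comp, comp_zero] }
  shape m m' h := by
    ext n
    exact K.shape₀ n m m' h
  d_comp_d' m m' m'' _ _ := by
    ext n
    exact K.d₀_comp_d₀ n m m' m''

/-! ### The totalization (through products) -/

section Tot

variable [HasLimits C]

/-- The object `∏_{i + j = n} X i j` of the totalization in degree `n`. -/
def totX (n : ℤ) : C := ∏ᶜ fun p : {p : ℤ × ℤ // p.1 + p.2 = n} => K.X p.1.1 p.1.2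

/-- The projections of the totalization to the objects of the bicomplex. -/
def totπ (n i j : ℤ) (h : i + j = n) : K.totX n ⟶ K.X i j :=
  Pi.π (fun p : {p : ℤ × ℤ // p.1 + p.2 = n} => K.X p.1.1 p.1.2) ⟨(i, j), h⟩

/-- The morphism to the totalization with given components. -/
def totLift {Z : C} (n : ℤ) (f : ∀ i j : ℤ, i + j = n → (Z ⟶ K.X i j)) : Z ⟶ K.totX n :=
  Pi.lift fun p => f p.1.1 p.1.2 p.2

theorem totLift_totπ {Z : C} (n : ℤ) (f : ∀ i j : ℤ, i + j = n → (Z ⟶ K.X i j)) (i j : ℤ)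
    (h : i + j = n) : K.totLift n f ≫ K.totπ n i j h = f i j h :=
  Pi.lift_π _ _

theorem totLift_totπ_assoc {Z Z' : C} (n : ℤ) (f : ∀ i j : ℤ, i + j = n → (Z ⟶ K.X i j))
    (i j : ℤ) (h : i + j = n) (g : K.X i j ⟶ Z') :
    K.totLift n f ≫ K.totπ n i j h ≫ g = f i j h ≫ g := by
  rw [← Category.assoc, totLift_totπ]

theorem totX_hom_ext {Z : C} {n : ℤ} {f g : Z ⟶ K.totX n}
    (hfg : ∀ i j h, f ≫ K.totπ n i j h = g ≫ K.totπ n i j h) : f = g :=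
  Pi.hom_ext _ _ fun p => hfg p.1.1 p.1.2 p.2

/-- The differential of the totalization: its component to `X i j` is the sum of the horizontal
differential on `X i (j - 1)` and of the vertical differential on `X (i - 1) j`. -/
def totD (n n' : ℤ) : K.totX n ⟶ K.totX n' :=
  if hn : n + 1 = n' then
    K.totLift n' fun i j h =>
      K.totπ n i (j - 1) (by lia) ≫ K.d₀ i (j - 1) j +
        K.totπ n (i - 1) j (by lia) ≫ K.d₁ (i - 1) i j
  else 0

/-- The totalization of a bicomplex (through products). -/
def tot : CochainComplex C ℤ where
  X n := K.totX n
  d n n' := K.totD n n'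
  shape n n' h := dif_neg h
  d_comp_d' n n' n'' h h' := by
    change n + 1 = n' at h
    change n' + 1 = n'' at h'
    subst h h'
    apply K.totX_hom_ext
    intro i j h
    have := K.anticomm (i - 1) i (j - 1) j
    simp only [totD, dif_pos, Category.assoc, totLift_totπ, Preadditive.comp_add,
      totLift_totπ_assoc, Preadditive.add_comp, K.d₀_comp_d₀, K.d₁_comp_d₁, comp_zero,
      zero_add, add_zero, zero_comp]
    rw [← Preadditive.comp_add, add_comm (K.d₁ _ _ _ ≫ _), this, comp_zero]

end Tot

/-! ### Augmentations -/

section Augmentation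

variable {K} {A : CochainComplex C ℤ}

variable (A) in
/-- A complex `A`, seen as a double complex concentrated in the row `0`. -/
abbrev stalkDouble : CochainComplex (CochainComplex C ℤ) ℤ :=
  ((HomologicalComplex.single C (ComplexShape.up ℤ) 0).mapHomologicalComplex
    (ComplexShape.up ℤ)).obj A

/-- The morphism from the stalk complex of `A^m` to the `m`-th column of a bicomplex induced
by a morphism `lam : A ⟶ C^{0,•}` such that `d₁ ∘ lam = 0`. -/
def augColumn (lam : A ⟶ K.row 0) (hlam : ∀ m, lam.f m ≫ K.d₁ 0 1 m = 0) (m : ℤ) :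
    (HomologicalComplex.single C (ComplexShape.up ℤ) 0).obj (A.X m) ⟶ K.column m :=
  HomologicalComplex.mkHomFromSingle (K := K.column m) (lam.f m) (by
    intro k hk
    obtain rfl : k = 1 := by
      change 0 + 1 = k at hk
      lia
    change lam.f m ≫ (m.negOnePow • K.d₁ 0 1 m) = 0
    rw [Linear.comp_units_smul, hlam, smul_zero])

theorem augColumn_comm (lam : A ⟶ K.row 0) (hlam : ∀ m, lam.f m ≫ K.d₁ 0 1 m = 0) (m m' : ℤ) :
    augColumn lam hlam m ≫ K.toDouble.d m m' =
      (HomologicalComplex.single C (ComplexShape.up ℤ) 0).map (A.d m m') ≫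
        augColumn lam hlam m' := by
  apply HomologicalComplex.from_single_hom_ext
  have := lam.comm m m'
  rw [HomologicalComplex.comp_f, HomologicalComplex.comp_f]
  simp [augColumn, HomologicalComplex.single_map_f_self, this]

/-- The morphism of double complexes induced by a morphism `lam : A ⟶ C^{0,•}` such that
`d₁ ∘ lam = 0`. -/
def augDouble (lam : A ⟶ K.row 0) (hlam : ∀ m, lam.f m ≫ K.d₁ 0 1 m = 0) :
    stalkDouble A ⟶ K.toDouble where
  f m := augColumn lam hlam m
  comm' m m' _ := augColumn_comm lam hlam m m'

/-- The `n`-coboundaries of a complex. -/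
abbrev coboundaries {D : Type*} [Category* D] [Abelian D] (L : CochainComplex D ℤ) (n : ℤ) : D :=
  image (L.d (n - 1) n)

/-- The induced morphism on the `n`-coboundaries. -/
def coboundariesMap {D : Type*} [Category* D] [Abelian D] {L L' : CochainComplex D ℤ}
    (f : L ⟶ L') (n : ℤ) : coboundaries L n ⟶ coboundaries L' n :=
  image.map (Arrow.homMk (f.f (n - 1)) (f.f n) (by simp) :
    Arrow.mk (L.d (n - 1) n) ⟶ Arrow.mk (L'.d (n - 1) n))

/-- `B^n(lam) : S^0(B^n(A)) ⟶ B^n(C₀)`. -/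
def augB (lam : A ⟶ K.row 0) (hlam : ∀ m, lam.f m ≫ K.d₁ 0 1 m = 0) (n : ℤ) :
    (HomologicalComplex.single C (ComplexShape.up ℤ) 0).obj (coboundaries A n) ⟶
      coboundaries K.toDouble n :=
  (PreservesImage.iso (HomologicalComplex.single C (ComplexShape.up ℤ) 0) (A.d (n - 1) n)).inv ≫
    coboundariesMap (augDouble lam hlam) n

/-- `H^n(lam) : S^0(H^n(A)) ⟶ H^n(C₀)`. -/
def augH (lam : A ⟶ K.row 0) (hlam : ∀ m, lam.f m ≫ K.d₁ 0 1 m = 0) (n : ℤ) :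
    (HomologicalComplex.single C (ComplexShape.up ℤ) 0).obj (A.homology n) ⟶
      K.toDouble.homology n :=
  ((A.sc n).mapHomologyIso (HomologicalComplex.single C (ComplexShape.up ℤ) 0)).inv ≫
    HomologicalComplex.homologyMap (augDouble lam hlam) n

/-- The components `A^n ⟶ C^{i,j}` (where `i + j = n`) of the morphism induced by `lam` to the
totalization: it is `lam^n` if `i = 0`, and it vanishes otherwise. -/
def augComponent (lam : A ⟶ K.row 0) (n i j : ℤ) (h : i + j = n) : A.X n ⟶ K.X i j :=
  if hi : i = 0 then
    (A.XIsoOfEq (by lia : n = j)).hom ≫ lam.f j ≫ eqToHom (by rw [hi])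
  else 0

theorem augComponent_zero (lam : A ⟶ K.row 0) (n : ℤ) (h : 0 + n = n) :
    augComponent lam n 0 n h = lam.f n := by
  simp [augComponent]

theorem augComponent_of_ne (lam : A ⟶ K.row 0) (n i j : ℤ) (h : i + j = n) (hi : i ≠ 0) :
    augComponent lam n i j h = 0 :=
  dif_neg hi

theorem augComponent_d₀ (lam : A ⟶ K.row 0) (n i j : ℤ) (h : i + (j - 1) = n)
    (h' : i + j = n + 1) :
    augComponent lam n i (j - 1) h ≫ K.d₀ i (j - 1) j =
      A.d n (n + 1) ≫ augComponent lam (n + 1) i j h' := by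
  by_cases hi : i = 0
  · subst hi
    generalize hk : j - 1 = k at h ⊢
    obtain rfl : k = n := by lia
    obtain rfl : j = k + 1 := by lia
    rw [augComponent_zero, augComponent_zero]
    exact lam.comm k (k + 1)
  · rw [augComponent_of_ne _ _ _ _ _ hi, augComponent_of_ne _ _ _ _ _ hi, zero_comp, comp_zero]

theorem augComponent_d₁ (lam : A ⟶ K.row 0) (hlam : ∀ m, lam.f m ≫ K.d₁ 0 1 m = 0)
    (n i i' j : ℤ) (h : i + j = n) (hi' : i + 1 = i') :
    augComponent lam n i j h ≫ K.d₁ i i' j = 0 := by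
  by_cases hi : i = 0
  · subst hi
    obtain rfl : j = n := by lia
    obtain rfl : i' = 1 := by lia
    rw [augComponent_zero, hlam]
  · rw [augComponent_of_ne _ _ _ _ _ hi, zero_comp]

/-- The morphism `A ⟶ Tot(C)` induced by an augmentation `lam : A ⟶ C^{0,•}`. -/
def augTot [HasLimits C] (lam : A ⟶ K.row 0) (hlam : ∀ m, lam.f m ≫ K.d₁ 0 1 m = 0) :
    A ⟶ K.tot where
  f n := K.totLift n (augComponent lam n)
  comm' n n' hn := by
    change n + 1 = n' at hn
    subst hn
    apply K.totX_hom_ext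
    intro i j h
    change (K.totLift n (augComponent lam n) ≫ K.totD n (n + 1)) ≫ K.totπ (n + 1) i j h =
      (A.d n (n + 1) ≫ K.totLift (n + 1) (augComponent lam (n + 1))) ≫ K.totπ (n + 1) i j h
    simp only [totD, dif_pos, Category.assoc, totLift_totπ, Preadditive.comp_add,
      totLift_totπ_assoc]
    rw [augComponent_d₀ lam n i j _ h, augComponent_d₁ lam hlam _ _ _ _ _ (by lia), add_zero]

end Augmentation

end Bicomplex

/-- Injective Cartan-Eilenberg resolutions `lam : A ⟶ C^{0,•}` of a complex `A`: lower half-plane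
bicomplexes of injectives with an augmentation, whose columns over the zero terms of `A` vanish,
such that `B^n(lam) : B^n(A) ⟶ B^n(C₀)` and `H^n(lam) : H^n(A) ⟶ H^n(C₀)` are injective
resolutions for all `n`. -/
structure IsCEResolution {A : CochainComplex C ℤ} (K : Bicomplex C) (lam : A ⟶ K.row 0) :
    Prop where
  lowerHalfPlane : ∀ n m, n < 0 → IsZero (K.X n m)
  injective : ∀ n m, Injective (K.X n m)
  aug_d₁ : ∀ m, lam.f m ≫ K.d₁ 0 1 m = 0
  isZero_column : ∀ m, IsZero (A.X m) → ∀ n, IsZero (K.X n m)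
  coboundaries : ∀ n, IsInjectiveResolution (Bicomplex.augB lam aug_d₁ n)
  homology : ∀ n, IsInjectiveResolution (Bicomplex.augH lam aug_d₁ n)

end CartanEilenberg

end

/-!
Let `K` be an injective Cartan-Eilenberg resolution of `A`, and write `B`, `Z`, `H` for the
coboundaries, cocycles and cohomology of `K` in the horizontal direction, as complexes in the
vertical direction. Since `0 → B → Z → H → 0` is exact, the cocycles are degreewise injective
along with `B` and `H`, and by the five lemma `Z^m` resolves `Z^m(A)`.

**The totalization is dg-injective.** This uses no hypothesis on products. A row of `K` is a
complex of injectives with injective cocycles, so every morphism to it from an acyclic complex is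
null-homotopic: such a row splits as a contractible complex and a complex with zero differential
(`exists_homotopy_row`). Since `K` has no rows of negative index, a null-homotopy of a morphism
`X ⟶ Tot(K)` can be built one row after the other (`isKInjective_tot`): the component of the
homotopy in one row corrects the obstruction created by the vertical differential of the
previous row. As the totalization is a product, infinitely many rows cause no trouble.

**The augmentation is a quasi-isomorphism.** Let the complex `A` be put in the row `-1`; the
totalization of the bicomplex so obtained has to be exact. If the horizontal differential were
zero, this would be the exactness of a product of exact columns, the `m`-th column being
considered in the degree `n - m`. All but finitely many columns (the columns with `n - m < -1`
are zero) are considered in degrees `> k`. There a product of injective resolutions is exact by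
(Ab.4*)-`k`: the part of the `m`-th column from the degree `n - m - k - 1` on is an injective
resolution of its first cocycles, so that the cohomology of the product is `∏^(k+1)` of these
(`AbFourStar.exists_lift`). The general case follows by using this twice: given a cocycle `x` of
the totalization, the family of the `d₀ x` lies in the columns `B`, where it is a vertical
coboundary; this allows to change `x` by a coboundary in such a way that `d₀ x = 0`, and then `x`
lies in the columns `Z` (`IsCEResolution.exists_tot_lift`).

Elements are replaced by morphisms `T ⟶ X`, up to precomposition with an epimorphism
`T' ⟶ T`. It is essential that a single epimorphism serves for all the columns: this is exactly
the exactness of the product.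
-/

noncomputable section

namespace CartanEilenberg

variable {C : Type u} [Category.{v} C] [Abelian C]

/-! ### Morphisms from acyclic complexes to complexes with injective cocycles -/

/-- If `Z^q(R)` is injective, then the differential `d : R^q ⟶ R^{q'}` is split, i.e. von Neumann
regular: its image is a direct summand of `R^{q'}`, with a section to `R^q`. -/
theorem exists_comp_comp_d_eq (R : CochainComplex C ℤ) (hR : ∀ q, Injective (R.X q))
    (hZ : ∀ q, Injective (R.cycles q)) (q q' : ℤ) :
    ∃ t : R.X q' ⟶ R.X q, R.d q q' ≫ t ≫ R.d q q' = R.d q q' := by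
  by_cases hq : q + 1 = q'
  · subst hq
    have := hR q
    have := hZ q
    have hex : (ShortComplex.mk (R.iCycles q) (R.d q (q + 1)) (by simp)).Exact :=
      ShortComplex.exact_of_f_is_kernel _ (R.cyclesIsKernel q (q + 1) (by simp))
    let r : R.X q ⟶ R.cycles q := Injective.factorThru (𝟙 _) (R.iCycles q)
    have hr : R.iCycles q ≫ r = 𝟙 _ := Injective.comp_factorThru _ _
    have h0 : R.iCycles q ≫ (𝟙 _ - r ≫ R.iCycles q) = 0 := by
      rw [Preadditive.comp_sub, reassoc_of% hr, Category.comp_id, sub_self]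
    -- the endomorphism `1 - r ≫ iCycles` of `R^q` kills the cocycles, hence factors as `d ≫ t`
    refine ⟨hex.descToInjective _ h0, ?_⟩
    have := hex.comp_descToInjective _ h0
    dsimp at this
    rw [reassoc_of% this, Preadditive.sub_comp, Category.assoc, R.iCycles_d, comp_zero, sub_zero,
      Category.id_comp]
  · exact ⟨0, by rw [R.shape _ _ hq]; simp⟩

theorem _root_.HomologicalComplex.Acyclic.exists_d_comp_eq {X : CochainComplex C ℤ}
    (hX : X.Acyclic) {p₀ p p' : ℤ} (h₀ : p₀ + 1 = p) (h : p + 1 = p') {J : C} [Injective J]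
    (a : X.X p ⟶ J) (ha : X.d p₀ p ≫ a = 0) : ∃ b : X.X p' ⟶ J, X.d p p' ≫ b = a := by
  have hex := hX p
  rw [X.exactAt_iff' p₀ p p' (by simp; lia) (by simp; lia)] at hex
  exact ⟨hex.descToInjective a ha, hex.comp_descToInjective a ha⟩

/-- A morphism from an acyclic complex `X` to a complex `R` of injectives with injective cocycles
is null-homotopic. The morphism has degree `-i`, and no sign appears in its compatibility with
the differentials, nor in the homotopy formula: these are the signs which occur for the `i`-th row
of a bicomplex. -/
theorem exists_homotopy_row (R : CochainComplex C ℤ) (hR : ∀ q, Injective (R.X q))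
    (hZ : ∀ q, Injective (R.cycles q)) (X : CochainComplex C ℤ) (hX : X.Acyclic) (i : ℤ)
    (g : ∀ p q : ℤ, i + q = p → (X.X p ⟶ R.X q))
    (hg : ∀ (p q p' q' : ℤ) (h : i + q = p) (h' : i + q' = p'), p + 1 = p' →
      g p q h ≫ R.d q q' = X.d p p' ≫ g p' q' h') :
    ∃ s : ∀ p q : ℤ, i + q + 1 = p → (X.X p ⟶ R.X q),
      ∀ (p q q₀ p' : ℤ) (h : i + q = p) (h₀ : i + q₀ + 1 = p) (h' : i + q + 1 = p'),
        g p q h = s p q₀ h₀ ≫ R.d q₀ q + X.d p p' ≫ s p' q h' := by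
  choose t ht using exists_comp_comp_d_eq R hR hZ
  -- `e` is an endomorphism of `R`, homotopic to the identity, with `d ≫ e = 0` and `e ≫ d = 0`
  let e (q₀ q q' : ℤ) : R.X q ⟶ R.X q := 𝟙 _ - t q₀ q ≫ R.d q₀ q - R.d q q' ≫ t q q'
  have he₁ (q₀ q q') : R.d q₀ q ≫ e q₀ q q' = 0 := by
    simp only [e, Preadditive.comp_sub, ht, Category.comp_id, R.d_comp_d_assoc, zero_comp,
      sub_self]
  have he₂ (q₀ q q') : e q₀ q q' ≫ R.d q q' = 0 := by
    simp only [e, Preadditive.sub_comp, Category.assoc, ht, Category.id_comp, R.d_comp_d,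
      comp_zero, sub_zero, sub_self]
  -- `g ≫ e` vanishes on coboundaries and takes values in the injective object of cocycles, so that
  -- it extends along the differential of the acyclic complex `X`
  have key (p' q : ℤ) (h : i + q + 1 = p') :
      ∃ k : X.X p' ⟶ R.X q, (∀ q', k ≫ R.d q q' = 0) ∧
        ∀ (p q₀ q' : ℤ) (hp : i + q = p), q₀ + 1 = q → q + 1 = q' →
          X.d p p' ≫ k = g p q hp ≫ e q₀ q q' := by
    have := hZ q
    let l : X.X (i + q) ⟶ R.cycles q := R.liftCycles (g (i + q) q rfl ≫ e (q - 1) q (q + 1))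
      (q + 1) (by simp) (by rw [Category.assoc, he₂, comp_zero])
    have hl : X.d (i + q - 1) (i + q) ≫ l = 0 := by
      rw [← cancel_mono (R.iCycles q), Category.assoc, R.liftCycles_i,
        ← reassoc_of% hg (i + q - 1) (q - 1) (i + q) q (by lia) rfl (by lia), he₁, comp_zero,
        zero_comp]
    obtain ⟨b, hb⟩ := hX.exists_d_comp_eq (p' := p') (by lia) h l hl
    refine ⟨b ≫ R.iCycles q, fun q' => by simp, ?_⟩
    rintro p q₀ q' hp h₀ rfl
    obtain rfl : q₀ = q - 1 := by lia
    subst hp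
    rw [reassoc_of% hb, R.liftCycles_i]
  choose k hk₁ hk₂ using key
  refine ⟨fun p q h => g p (q + 1) (by lia) ≫ t q (q + 1) + k p q h, ?_⟩
  intro p q q₀ p' h h₀ h'
  obtain rfl : q = q₀ + 1 := by lia
  obtain rfl : p' = p + 1 := by lia
  have h3 := hk₂ (p + 1) (q₀ + 1) h' p q₀ (q₀ + 1 + 1) h rfl rfl
  rw [Preadditive.add_comp, hk₁, add_zero, Preadditive.comp_add, h3,
    ← reassoc_of% hg p (q₀ + 1) (p + 1) (q₀ + 1 + 1) h (by lia) rfl]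
  simp only [e, Preadditive.comp_sub, Category.assoc, Category.comp_id]
  abel

/-- Dependent choice for a relation between consecutive terms of a sequence, in the form where a
term may be chosen only if the two previous terms are related. -/
theorem exists_seq_of_step {H : ℕ → Type*} (P : ∀ i, H i → H (i + 1) → Prop)
    (a : H 0) (h₀ : ∃ b, P 0 a b) (step : ∀ i x y, P i x y → ∃ z, P (i + 1) y z) :
    ∃ s : ∀ i, H i, ∀ i, P i (s i) (s (i + 1)) := by
  obtain ⟨b, hb⟩ := h₀
  choose f hf using step
  let S (i : ℕ) : {x : H i × H (i + 1) // P i x.1 x.2} :=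
    Nat.rec ⟨(a, b), hb⟩ (fun i x => ⟨(x.1.2, f i _ _ x.2), hf i _ _ x.2⟩) i
  exact ⟨fun i => (S i).1.1, fun i => (S i).2⟩

/-! ### dg-injectivity of the totalization -/

section

open CochainComplex.HomComplex

namespace Bicomplex

section
variable [HasLimits C] (K : Bicomplex C)

/-- The projections `K.totπ`, with source the object `K.tot.X n`. -/
def totProj (n i j : ℤ) (h : i + j = n) : K.tot.X n ⟶ K.X i j := K.totπ n i j h

/-- The lift `K.totLift`, with target the object `K.tot.X n`. -/
def totProdLift {Z : C} (n : ℤ) (f : ∀ i j : ℤ, i + j = n → (Z ⟶ K.X i j)) : Z ⟶ K.tot.X n :=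
  K.totLift n f

theorem totProdLift_totProj {Z : C} (n : ℤ) (f : ∀ i j : ℤ, i + j = n → (Z ⟶ K.X i j)) (i j : ℤ)
    (h : i + j = n) : K.totProdLift n f ≫ K.totProj n i j h = f i j h :=
  K.totLift_totπ _ _ _ _ _

theorem totProdLift_totProj_assoc {Z Z' : C} (n : ℤ) (f : ∀ i j : ℤ, i + j = n → (Z ⟶ K.X i j))
    (i j : ℤ) (h : i + j = n) (g : K.X i j ⟶ Z') :
    K.totProdLift n f ≫ K.totProj n i j h ≫ g = f i j h ≫ g := by
  rw [← Category.assoc, totProdLift_totProj]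

theorem tot_hom_ext {Z : C} {n : ℤ} {f g : Z ⟶ K.tot.X n}
    (hfg : ∀ i j h, f ≫ K.totProj n i j h = g ≫ K.totProj n i j h) : f = g :=
  K.totX_hom_ext hfg

theorem tot_d_totProj (n n' i i₀ j j₀ : ℤ) (hn : n + 1 = n')
    (hi : i₀ + 1 = i) (hj : j₀ + 1 = j) (h : i + j = n') :
    K.tot.d n n' ≫ K.totProj n' i j h =
      K.totProj n i j₀ (by lia) ≫ K.d₀ i j₀ j + K.totProj n i₀ j (by lia) ≫ K.d₁ i₀ i j := by
  obtain rfl : i₀ = i - 1 := by lia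
  obtain rfl : j₀ = j - 1 := by lia
  change K.totD n n' ≫ K.totπ n' i j h = K.totπ n i (j - 1) _ ≫ _ + K.totπ n (i - 1) j _ ≫ _
  rw [totD, dif_pos hn, totLift_totπ]
  rfl

end

variable {K : Bicomplex C} {X : CochainComplex C ℤ}

/-- If the `m`-th row `s` of a null-homotopy of `φ` is given, and the difference of `φ` and of the
vertical part of the homotopy is compatible with the horizontal differentials in the row `m' = m + 1`,
then there is an `m'`-th row `s'` of the homotopy. -/
theorem exists_homotopy_step (hinj : ∀ n m, Injective (K.X n m))
    (hZ : ∀ n m, Injective ((K.row n).cycles m)) (hX : X.Acyclic)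
    (φ : ∀ p n q : ℤ, n + q = p → (X.X p ⟶ K.X n q)) (m m' : ℤ) (hm : m + 1 = m')
    (s : ∀ p q : ℤ, m + q + 1 = p → (X.X p ⟶ K.X m q))
    (hs : ∀ (p p' q q' : ℤ) (h : m' + q = p) (_ : q + 1 = q') (_ : p + 1 = p'),
      (φ p m' q h - s p q (by lia) ≫ K.d₁ m m' q) ≫ K.d₀ m' q q' =
        X.d p p' ≫ (φ p' m' q' (by lia) - s p' q' (by lia) ≫ K.d₁ m m' q')) :
    ∃ s' : ∀ p q : ℤ, m' + q + 1 = p → (X.X p ⟶ K.X m' q),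
      ∀ (p p' q q₀ : ℤ) (h : m' + q = p) (hq : q₀ + 1 = q) (hp : p + 1 = p'),
        φ p m' q h = s' p q₀ (by lia) ≫ K.d₀ m' q₀ q + s p q (by lia) ≫ K.d₁ m m' q +
          X.d p p' ≫ s' p' q (by lia) := by
  obtain ⟨t, ht⟩ := exists_homotopy_row (K.row m') (hinj m') (hZ m') X hX m'
    (fun p q h => φ p m' q h - s p q (by lia) ≫ K.d₁ m m' q)
    (fun p q p' q' h h' hp => hs p p' q q' h (by lia) hp)
  refine ⟨t, fun p p' q q₀ h hq hp => ?_⟩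
  rw [sub_eq_iff_eq_add.1 (ht p q q₀ p' h (by lia) (by lia))]
  abel

/-- The compatibility needed to construct the row `m' = m + 1` of the homotopy follows from the
homotopy formula in the row `m`. -/
theorem homotopy_step_compat
    (φ : ∀ p n q : ℤ, n + q = p → (X.X p ⟶ K.X n q))
    (hφ : ∀ (n n' p p' q q' : ℤ) (_ : n + 1 = n') (_ : p + 1 = p') (_ : q + 1 = q')
      (h : n' + q' = p'),
      φ p n' q (by lia) ≫ K.d₀ n' q q' + φ p n q' (by lia) ≫ K.d₁ n n' q' =
        X.d p p' ≫ φ p' n' q' h)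
    (m₀ m m' : ℤ) (hm : m + 1 = m')
    (s : ∀ p q : ℤ, m₀ + q + 1 = p → (X.X p ⟶ K.X m₀ q))
    (s' : ∀ p q : ℤ, m + q + 1 = p → (X.X p ⟶ K.X m q)) (hm₀ : m₀ + 1 = m)
    (hs : ∀ (p p' q q₀ : ℤ) (h : m + q = p) (hq : q₀ + 1 = q) (hp : p + 1 = p'),
        φ p m q h = s' p q₀ (by lia) ≫ K.d₀ m q₀ q + s p q (by lia) ≫ K.d₁ m₀ m q +
          X.d p p' ≫ s' p' q (by lia))
    (p p' q q' : ℤ) (h : m' + q = p) (hq : q + 1 = q') (hp : p + 1 = p') :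
      (φ p m' q h - s' p q (by lia) ≫ K.d₁ m m' q) ≫ K.d₀ m' q q' =
        X.d p p' ≫ (φ p' m' q' (by lia) - s' p' q' (by lia) ≫ K.d₁ m m' q') := by
  have h1 := hφ m m' p p' q q' hm hp hq (by lia)
  have h4 := hs p p' q' q (by lia) hq hp =≫ K.d₁ m m' q'
  have h3 := eq_neg_of_add_eq_zero_left (K.anticomm m m' q q')
  simp only [Preadditive.add_comp, Category.assoc, h3, K.d₁_comp_d₁, comp_zero,
    add_zero] at h4
  rw [Preadditive.sub_comp, Preadditive.comp_sub, ← h1, h4, Category.assoc, Preadditive.comp_neg]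
  abel

/-- A morphism from an acyclic complex to the totalization, given by its components `φ`, has a
null-homotopy, given by its components `S`. -/
theorem exists_homotopy_components (hneg : ∀ n m, n < 0 → IsZero (K.X n m))
    (hinj : ∀ n m, Injective (K.X n m)) (hZ : ∀ n m, Injective ((K.row n).cycles m))
    (hX : X.Acyclic) (φ : ∀ p n q : ℤ, n + q = p → (X.X p ⟶ K.X n q))
    (hφ : ∀ (n n' p p' q q' : ℤ) (_ : n + 1 = n') (_ : p + 1 = p') (_ : q + 1 = q')
      (h : n' + q' = p'),
      φ p n' q (by lia) ≫ K.d₀ n' q q' + φ p n q' (by lia) ≫ K.d₁ n n' q' =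
        X.d p p' ≫ φ p' n' q' h) :
    ∃ S : ∀ n p q : ℤ, n + q + 1 = p → (X.X p ⟶ K.X n q),
      ∀ (n n' p p' q q₀ : ℤ) (hn : n + 1 = n') (h : n' + q = p) (hq : q₀ + 1 = q) (hp : p + 1 = p'),
        φ p n' q h = S n' p q₀ (by lia) ≫ K.d₀ n' q₀ q + S n p q (by lia) ≫ K.d₁ n n' q +
          X.d p p' ≫ S n' p' q (by lia) := by
  have hstep := exists_homotopy_step hinj hZ hX φ
  -- the `i`-th term of the sequence is the row `n = i - 1` of the homotopy
  obtain ⟨s, hs⟩ := exists_seq_of_step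
    (H := fun i : ℕ => ∀ n : ℤ, n + 1 = i → ∀ p q : ℤ, n + q + 1 = p → (X.X p ⟶ K.X n q))
    (fun i s s' => ∀ (n n' p p' q q₀ : ℤ) (hn : n + 1 = i) (hn' : n' + 1 = (i + 1 : ℕ))
        (h : n' + q = p) (hq : q₀ + 1 = q) (hp : p + 1 = p'),
        φ p n' q h = s' n' hn' p q₀ (by lia) ≫ K.d₀ n' q₀ q +
          s n hn p q (by lia) ≫ K.d₁ n n' q + X.d p p' ≫ s' n' hn' p' q (by lia))
    (fun _ _ _ _ _ => 0) (by
      obtain ⟨t, ht⟩ := hstep (-1) 0 (by lia) (fun _ _ _ => 0) (by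
        intro p p' q q' h hq hp
        have := hφ (-1) 0 p p' q q' (by lia) hp hq (by lia)
        rw [(hneg (-1) q' (by lia)).eq_of_tgt (φ p (-1) q' _) 0, zero_comp, add_zero] at this
        simpa only [zero_comp, sub_zero] using this)
      refine ⟨fun n hn p q h => t p q (by push_cast at hn; lia) ≫
        eqToHom (by rw [show n = 0 by push_cast at hn; lia]), ?_⟩
      intro n n' p p' q q₀ hn hn' h hq hp
      obtain rfl : n = -1 := by push_cast at hn; lia
      obtain rfl : n' = 0 := by push_cast at hn'; lia
      simpa using ht p p' q q₀ h hq hp) (by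
      intro i s s' hss
      have hc := homotopy_step_compat φ hφ (i - 1) i (i + 1) rfl (s (i - 1) (by lia))
        (s' i (by push_cast; rfl)) (by lia) (fun p p' q q₀ h hq hp =>
          hss (i - 1) i p p' q q₀ _ _ h hq hp)
      obtain ⟨t, ht⟩ := hstep i (i + 1) rfl _ hc
      refine ⟨fun n hn p q h => t p q (by push_cast at hn; lia) ≫
        eqToHom (by rw [show n = i + 1 by push_cast at hn; lia]), ?_⟩
      intro n n' p p' q q₀ hn hn' h hq hp
      obtain rfl : n = i := by push_cast at hn; lia
      obtain rfl : n' = i + 1 := by push_cast at hn'; lia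
      simpa using ht p p' q q₀ h hq hp)
  let S (n p q : ℤ) (h : n + q + 1 = p) : X.X p ⟶ K.X n q :=
    if hn : 0 ≤ n + 1 then s (n + 1).toNat n (by lia) p q h else 0
  have hS (i : ℕ) (n p q : ℤ) (hn : n + 1 = i) (h : n + q + 1 = p) :
      S n p q h = s i n hn p q h := by
    obtain rfl : i = (n + 1).toNat := by lia
    exact dif_pos (by lia)
  clear_value S
  refine ⟨S, fun n n' p p' q q₀ hn h hq hp => ?_⟩
  by_cases hn' : n' < 0
  · exact (hneg n' q hn').eq_of_tgt _ _
  · obtain ⟨i, rfl⟩ : ∃ i : ℕ, n' = i := ⟨n'.toNat, by lia⟩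
    have hi : (i : ℤ) + 1 = (i + 1 : ℕ) := (Nat.cast_succ i).symm
    rw [hS i n p q hn, hS (i + 1) i p q₀ hi, hS (i + 1) i p' q hi]
    exact hs i n i p p' q q₀ hn _ h hq hp

theorem isKInjective_tot [HasLimits C] (hneg : ∀ n m, n < 0 → IsZero (K.X n m))
    (hinj : ∀ n m, Injective (K.X n m)) (hZ : ∀ n m, Injective ((K.row n).cycles m)) :
    K.tot.IsKInjective where
  nonempty_homotopy_zero {X} f hX := by
    obtain ⟨S, hS⟩ := exists_homotopy_components hneg hinj hZ hX
      (fun p n q h => f.f p ≫ K.totProj p n q h) (by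
        intro n n' p p' q q' hn hp hq h
        rw [← f.comm_assoc, K.tot_d_totProj p p' n' n q' q hp hn hq h, Preadditive.comp_add,
          Category.assoc, Category.assoc])
    refine ⟨(Cochain.equivHomotopy f 0).symm ⟨Cochain.mk (fun p q hpq =>
      K.totProdLift q (fun a b h => S a p b (by lia))), ?_⟩⟩
    ext p
    rw [Cochain.add_v, δ_v (-1) 0 (by lia) _ p p (by lia) (p - 1) (p + 1) rfl rfl]
    simp only [Cochain.ofHom_v, Cochain.mk_v, HomologicalComplex.zero_f, add_zero]
    apply K.tot_hom_ext
    intro a b h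
    rw [hS (a - 1) a p (p + 1) b (b - 1) (by lia) h (by lia) rfl]
    simp only [Preadditive.add_comp, Category.assoc, Int.negOnePow_zero, one_smul]
    rw [K.tot_d_totProj (p - 1) p a (a - 1) b (b - 1) (by lia) (by lia) (by lia) h]
    simp only [Preadditive.comp_add, totProdLift_totProj, totProdLift_totProj_assoc]

theorem injective_tot_X [HasLimits C] (hinj : ∀ n m, Injective (K.X n m)) (n : ℤ) :
    Injective (K.tot.X n) := by
  change Injective (∏ᶜ fun p : {p : ℤ × ℤ // p.1 + p.2 = n} => K.X p.1.1 p.1.2)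
  infer_instance

end Bicomplex

theorem isDGInjective_of_isKInjective (E : CochainComplex C ℤ) (hE : ∀ n, Injective (E.X n))
    [E.IsKInjective] : IsDGInjective E where
  injective := hE
  acyclic_homComplex X hX n := by
    rw [HomologicalComplex.exactAt_iff' _ (n - 1) n (n + 1) (by simp) (by simp),
      ShortComplex.ab_exact_iff]
    intro z hz
    obtain ⟨w, hw⟩ := CochainComplex.IsKInjective.eq_δ_of_cocycle
      (Cocycle.mk z (n + 1) rfl hz) hX (n - 1) (by lia)
    exact ⟨w, hw⟩

end

/-! ### The short exact sequence of coboundaries, cocycles and cohomology -/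

namespace Bicomplex
section
variable {D : Type*} [Category* D] [Abelian D]

/-- The inclusion `B^n(L) ⟶ Z^n(L)`. -/
def coboundariesToCycles (L : CochainComplex D ℤ) (n : ℤ) : coboundaries L n ⟶ L.cycles n :=
  L.liftCycles (image.ι (L.d (n - 1) n)) (n + 1) (by simp) (by
    rw [← cancel_epi (factorThruImage (L.d (n - 1) n)), image.fac_assoc, L.d_comp_d, comp_zero])

theorem coboundariesToCycles_iCycles (L : CochainComplex D ℤ) (n : ℤ) :
    coboundariesToCycles L n ≫ L.iCycles n = image.ι (L.d (n - 1) n) := by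
  simp [coboundariesToCycles]

theorem factorThruImage_coboundariesToCycles (L : CochainComplex D ℤ) (n : ℤ) :
    factorThruImage (L.d (n - 1) n) ≫ coboundariesToCycles L n = L.toCycles (n - 1) n := by
  rw [← cancel_mono (L.iCycles n), Category.assoc, coboundariesToCycles_iCycles, image.fac,
    L.toCycles_i]

/-- The short complex `B^n(L) ⟶ Z^n(L) ⟶ H^n(L)`. -/
def cyclesShortComplex (L : CochainComplex D ℤ) (n : ℤ) : ShortComplex D where
  X₁ := coboundaries L n
  X₂ := L.cycles n
  X₃ := L.homology n
  f := coboundariesToCycles L n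
  g := L.homologyπ n
  zero := by
    rw [← cancel_epi (factorThruImage (L.d (n - 1) n)), ← Category.assoc,
      factorThruImage_coboundariesToCycles, L.toCycles_comp_homologyπ, comp_zero]

theorem cyclesShortComplex_shortExact (L : CochainComplex D ℤ) (n : ℤ) :
    (cyclesShortComplex L n).ShortExact where
  exact := by
    rw [ShortComplex.exact_iff_exact_up_to_refinements]
    intro T x hx
    obtain ⟨T', π, hπ, y, hy⟩ := (L.comp_homologyπ_eq_zero_iff_up_to_refinements (n - 1) n
      (by simp) x).1 hx
    refine ⟨T', π, hπ, y ≫ factorThruImage (L.d (n - 1) n), ?_⟩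
    exact hy.trans ((congrArg (y ≫ ·) (factorThruImage_coboundariesToCycles L n).symm).trans
      (Category.assoc _ _ _).symm)
  mono_f := by
    have : Mono (coboundariesToCycles L n ≫ L.iCycles n) := by
      rw [coboundariesToCycles_iCycles]
      infer_instance
    exact mono_of_mono (coboundariesToCycles L n) (L.iCycles n)
  epi_g := inferInstanceAs (Epi (L.homologyπ n))

/-- The functoriality of the short complex `B^n(L) ⟶ Z^n(L) ⟶ H^n(L)`. -/
def cyclesShortComplexMap {L L' : CochainComplex D ℤ} (φ : L ⟶ L') (n : ℤ) :
    cyclesShortComplex L n ⟶ cyclesShortComplex L' n where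
  τ₁ := coboundariesMap φ n
  τ₂ := HomologicalComplex.cyclesMap φ n
  τ₃ := HomologicalComplex.homologyMap φ n
  comm₁₂ := by
    change coboundariesMap φ n ≫ coboundariesToCycles L' n =
      coboundariesToCycles L n ≫ HomologicalComplex.cyclesMap φ n
    rw [← cancel_mono (L'.iCycles n), Category.assoc, Category.assoc,
      HomologicalComplex.cyclesMap_i, coboundariesToCycles_iCycles, ← Category.assoc,
      coboundariesToCycles_iCycles]
    exact image.map_homMk'_ι _
  comm₂₃ := (HomologicalComplex.homologyπ_naturality φ n).symm

end
end Bicomplex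

theorem injective_X₂_of_shortExact {S : ShortComplex C} (hS : S.ShortExact) (h₁ : Injective S.X₁)
    (h₃ : Injective S.X₃) : Injective S.X₂ := by
  have := hS.mono_f
  exact Injective.of_iso (hS.splittingOfInjective).isoBinaryBiproduct.symm inferInstance

open HomologicalComplex HomologySequence Abelian ComposableArrows in
theorem quasiIso_τ₂ {S₁ S₂ : ShortComplex (CochainComplex C ℤ)} (φ : S₁ ⟶ S₂)
    (hS₁ : S₁.ShortExact) (hS₂ : S₂.ShortExact) (h₁ : QuasiIso φ.τ₁) (h₃ : QuasiIso φ.τ₃) :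
    QuasiIso φ.τ₂ := by
  rw [quasiIso_iff]
  intro i
  rw [quasiIsoAt_iff_isIso_homologyMap]
  have h₁' (i) : IsIso (homologyMap φ.τ₁ i) := inferInstance
  have h₃' (i) : IsIso (homologyMap φ.τ₃ i) := inferInstance
  have : Mono (homologyMap φ.τ₂ i) := by
    have hi : (ComplexShape.up ℤ).Rel (i - 1) i := by simp
    apply mono_of_epi_of_mono_of_mono
      ((δ₀Functor ⋙ δ₀Functor).map (mapComposableArrows₅ φ hS₁ hS₂ (i - 1) i hi))
    · exact (composableArrows₅_exact hS₁ _ i hi).δ₀.δ₀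
    · exact (composableArrows₅_exact hS₂ _ i hi).δ₀.δ₀
    · exact (inferInstance : Epi (homologyMap φ.τ₃ (i - 1)))
    · exact (inferInstance : Mono (homologyMap φ.τ₁ i))
    · exact (inferInstance : Mono (homologyMap φ.τ₃ i))
  have : Epi (homologyMap φ.τ₂ i) := by
    have hi : (ComplexShape.up ℤ).Rel i (i + 1) := by simp
    apply epi_of_epi_of_epi_of_mono
      ((δlastFunctor ⋙ δlastFunctor).map (mapComposableArrows₅ φ hS₁ hS₂ i (i + 1) hi))
    · exact (composableArrows₅_exact hS₁ _ _ hi).δlast.δlast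
    · exact (composableArrows₅_exact hS₂ _ _ hi).δlast.δlast
    · exact (inferInstance : Epi (homologyMap φ.τ₁ i))
    · exact (inferInstance : Epi (homologyMap φ.τ₃ i))
    · exact (inferInstance : Mono (homologyMap φ.τ₁ (i + 1)))
  apply isIso_of_mono_of_epi

/-! ### Products of injective resolutions under (Ab.4*)-`k` -/

theorem exact_of_exact_evaluation {J : Type*} [Category* J] (S : ShortComplex (J ⥤ C))
    (h : ∀ j, (S.map ((evaluation J C).obj j)).Exact) : S.Exact := by
  rw [ShortComplex.exact_iff_isZero_homology, Functor.isZero_iff]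
  intro j
  exact ((S.mapHomologyIso ((evaluation J C).obj j)).symm.isZero_iff).2
    ((ShortComplex.exact_iff_isZero_homology _).1 (h j))

section
variable {ι : Type v} (I : ι → CochainComplex C ℤ) (a : ι → ℤ)

/-- The complex of families which in degree `t` consists of the objects `I_j^{a_j + t}`. -/
def familyComplex : CochainComplex (Discrete ι ⥤ C) ℕ where
  X t := Discrete.functor fun j => (I j).X (a j + t)
  d t t' := Discrete.natTrans fun j => (I j.as).d (a j.as + t) (a j.as + t')
  shape t t' h := by
    ext j
    exact (I j.as).shape _ _ fun h' => h (by change _ + _ = _ at h'; change t + 1 = t'; lia)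
  d_comp_d' t t' t'' h h' := by
    ext j
    exact (I j.as).d_comp_d _ _ _

/-- The family of the cocycles of `I_j` in degree `a_j`. The summand `(0 : ℕ)` is kept, so that the
indices agree definitionally with those of `familyComplex`. -/
def familyCycles : Discrete ι ⥤ C := Discrete.functor fun j => (I j).cycles (a j + (0 : ℕ))

/-- The inclusion of the cocycles in the degree `0` term of `familyComplex`. -/
def familyι : familyCycles I a ⟶ (familyComplex I a).X 0 :=
  Discrete.natTrans fun j => (I j.as).iCycles (a j.as + (0 : ℕ))

theorem familyι_d : familyι I a ≫ (familyComplex I a).d 0 1 = 0 := by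
  ext j
  exact (I j.as).iCycles_d _ _

/-- If the complexes `I_j` are degreewise injective, and exact in degrees `> a_j`, then their parts in
degrees `≥ a_j` form an injective resolution of the family of the cocycles in degrees `a_j`. -/
def familyResolution (hI : ∀ j n, Injective ((I j).X n))
    (hex : ∀ j (t : ℕ), (I j).ExactAt (a j + (t + 1 : ℕ))) :
    InjectiveResolution (familyCycles I a) where
  cocomplex := familyComplex I a
  injective t := injective_of_forall _ fun j => hI _ _
  ι := (CochainComplex.fromSingle₀Equiv _ _).symm ⟨familyι I a, familyι_d I a⟩
  quasiIso := ⟨fun t => by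
    have hf := CochainComplex.fromSingle₀Equiv_symm_apply_f_zero (C := familyComplex I a)
      (familyι I a) (familyι_d I a)
    cases t with
    | zero =>
      rw [CochainComplex.quasiIsoAt₀_iff, ShortComplex.quasiIso_iff_of_zeros]
      · refine (ShortComplex.exact_and_mono_f_iff_of_iso ?_).2
          (⟨?_, ?_⟩ : (ShortComplex.mk (familyι I a) ((familyComplex I a).d 0 1)
            (familyι_d I a)).Exact ∧ Mono (familyι I a))
        · exact ShortComplex.isoMk (Iso.refl _) (Iso.refl _) (Iso.refl _)
            ((Category.id_comp _).trans
              (Eq.trans hf.symm (Category.comp_id _).symm))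
            ((Category.id_comp _).trans (Category.comp_id _).symm)
        · apply exact_of_exact_evaluation
          intro j
          exact ShortComplex.exact_of_f_is_kernel _
            ((I j.as).cyclesIsKernel (a j.as + (0 : ℕ)) (a j.as + (1 : ℕ)) (by simp))
        · have : ∀ j, Mono ((familyι I a).app j) := fun j => by
            dsimp [familyι, familyCycles, familyComplex]
            infer_instance
          exact NatTrans.mono_of_mono_app _
      · rfl
      · rfl
      · exact (familyComplex I a).shape 0 0 (by simp)
    | succ t =>
      rw [quasiIsoAt_iff_exactAt]
      · rw [HomologicalComplex.exactAt_iff' _ t (t + 1) (t + 2) (by simp) (by simp)]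
        apply exact_of_exact_evaluation
        intro j
        exact ((I j.as).exactAt_iff' (a j.as + t) (a j.as + (t + 1 : ℕ)) (a j.as + (t + 2 : ℕ))
          (by simp; lia) (by simp; lia)).1 (hex j.as t)
      · apply CochainComplex.exactAt_succ_single_obj⟩

/-- If the complexes `I_j` are degreewise injective, and exact in degrees `> a_j`, then the product of
the `I_j[a_j]` is exact in degree `k + 1` under (Ab.4*)-`k`: its cohomology there is the derived
product `∏^(k+1)` of the cocycles of `I_j` in degrees `a_j`. -/
theorem AbFourStar.exists_family_lift [HasLimits C] [EnoughInjectives C] {k : ℕ}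
    (hk : AbFourStar C k) (hI : ∀ j n, Injective ((I j).X n))
    (hex : ∀ j (t : ℕ), (I j).ExactAt (a j + (t + 1 : ℕ)))
    {T : C} (y : ∀ j, T ⟶ (I j).X (a j + (k + 1 : ℕ)))
    (hy : ∀ j, y j ≫ (I j).d _ (a j + (k + 2 : ℕ)) = 0) :
    ∃ (T' : C) (π : T' ⟶ T) (_ : Epi π) (w : ∀ j, T' ⟶ (I j).X (a j + k)),
      ∀ j, π ≫ y j = w j ≫ (I j).d _ _ := by
  have h0 := (((familyResolution I a hI hex).isoRightDerivedObj (prodFunctor C ι)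
    (k + 1)).isZero_iff).1 (hk ι _ (k + 1) (by lia))
  have hE : HomologicalComplex.ExactAt (((prodFunctor C ι).mapHomologicalComplex
      (ComplexShape.up ℕ)).obj (familyComplex I a)) (k + 1) :=
    (HomologicalComplex.exactAt_iff_isZero_homology _ _).2 h0
  rw [HomologicalComplex.exactAt_iff_exact_up_to_refinements _ k (k + 1) (k + 2)
    (by simp) (by simp)] at hE
  replace hE : ∀ ⦃A : C⦄ (x : A ⟶ limit ((familyComplex I a).X (k + 1))),
      x ≫ limMap ((familyComplex I a).d (k + 1) (k + 2)) = 0 →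
      ∃ (A' : C) (π : A' ⟶ A) (_ : Epi π) (x' : A' ⟶ limit ((familyComplex I a).X k)),
        π ≫ x = x' ≫ limMap ((familyComplex I a).d k (k + 1)) := hE
  let π' (t : ℕ) (j : ι) : limit ((familyComplex I a).X t) ⟶ (I j).X (a j + t) :=
    limit.π ((familyComplex I a).X t) ⟨j⟩
  have hπ (t t' : ℕ) (j : ι) : limMap ((familyComplex I a).d t t') ≫ π' t' j =
      π' t j ≫ (I j).d (a j + t) (a j + t') := limMap_π _ _
  let Y : T ⟶ limit ((familyComplex I a).X (k + 1)) :=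
    limit.lift _ ⟨T, Discrete.natTrans (F := (Functor.const _).obj T)
      (G := (familyComplex I a).X (k + 1)) fun j => y j.as⟩
  have hY (j : ι) : Y ≫ π' (k + 1) j = y j := limit.lift_π _ (Discrete.mk j)
  obtain ⟨T', π, _, w, hw⟩ := hE Y (by
    apply limit.hom_ext
    rintro ⟨j⟩
    have := hπ (k + 1) (k + 2) j
    refine (Category.assoc _ _ _).trans ((congrArg (Y ≫ ·) this).trans ?_)
    rw [zero_comp]
    exact (Category.assoc _ _ _).symm.trans ((congrArg (· ≫ _) (hY j)).trans (hy j)))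
  refine ⟨T', π, inferInstance, fun j => w ≫ π' k j, fun j => ?_⟩
  have := hw =≫ π' (k + 1) j
  rw [Category.assoc, hY, Category.assoc, hπ] at this
  exact this.trans (Category.assoc _ _ _).symm

end

theorem exists_lift_of_lt (I : ℕ → CochainComplex C ℤ)
    (hex : ∀ j (n : ℤ), 0 < n → (I j).ExactAt n) {T : C} (y : ∀ j : ℕ, T ⟶ (I j).X (j + 1))
    (hy : ∀ j : ℕ, y j ≫ (I j).d (j + 1) (j + 2) = 0) (N : ℕ) :
    ∃ (T' : C) (π : T' ⟶ T) (_ : Epi π), ∀ j < N, ∃ w : T' ⟶ (I j).X j,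
      π ≫ y j = w ≫ (I j).d j (j + 1) := by
  induction N with
  | zero => exact ⟨T, 𝟙 T, inferInstance, by simp⟩
  | succ N ih =>
    obtain ⟨T₁, π₁, _, h₁⟩ := ih
    obtain ⟨T₂, π₂, _, w, hw⟩ := ((I N).exactAt_iff_exact_up_to_refinements N (N + 1) (N + 2)
      (by simp) (by simp; lia)).1 (hex N (N + 1) (by lia)) (π₁ ≫ y N)
        (by rw [Category.assoc, hy, comp_zero])
    refine ⟨T₂, π₂ ≫ π₁, inferInstance, fun j hj => ?_⟩
    obtain hj | rfl := Nat.lt_succ_iff_lt_or_eq.1 hj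
    · obtain ⟨w', hw'⟩ := h₁ j hj
      exact ⟨π₂ ≫ w', by rw [Category.assoc, hw', Category.assoc]⟩
    · exact ⟨w, by rw [Category.assoc, hw]⟩

/-- Under (Ab.4*)-`k`, the product of the complexes `I_j[j]` is exact in degree `1`, if all the `I_j`
are degreewise injective, and exact in positive degrees: for the finitely many `j < k` this is a
question about finite products, and the other `I_j` are considered in degrees `j + 1 > k`. -/
theorem AbFourStar.exists_lift [HasLimits C] [EnoughInjectives C] {k : ℕ}
    (hk : AbFourStar C k) (I : ℕ → CochainComplex C ℤ) (hI : ∀ j n, Injective ((I j).X n))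
    (hex : ∀ j (n : ℤ), 0 < n → (I j).ExactAt n) {T : C} (y : ∀ j : ℕ, T ⟶ (I j).X (j + 1))
    (hy : ∀ j : ℕ, y j ≫ (I j).d (j + 1) (j + 2) = 0) :
    ∃ (T' : C) (π : T' ⟶ T) (_ : Epi π) (w : ∀ j : ℕ, T' ⟶ (I j).X j),
      ∀ j, π ≫ y j = w j ≫ (I j).d j (j + 1) := by
  obtain ⟨T₁, π₁, _, h₁⟩ := exists_lift_of_lt I hex y hy k
  let J (l : ULift.{v} ℕ) := I (l.down + k)
  -- `z l` is `y (l + k)`, up to the identification of the indices `(l + k) + 1` and `l + (k + 1)`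
  have hz (l : ULift.{v} ℕ) : ∃ z : T ⟶ (J l).X ((l.down : ℤ) + (k + 1 : ℕ)),
      (∀ m, z ≫ (J l).d _ m = y (l.down + k) ≫ (J l).d _ m) ∧
      ∀ (T' : C) (π : T' ⟶ T) (w : T' ⟶ (J l).X ((l.down : ℤ) + k)),
        π ≫ z = w ≫ (J l).d _ _ → ∃ w', π ≫ y (l.down + k) = w' ≫ (J l).d (l.down + k : ℕ) _ := by
    have h1 : ((l.down + k : ℕ) : ℤ) + 1 = (l.down : ℤ) + (k + 1 : ℕ) := by push_cast; lia
    have h2 : ((l.down + k : ℕ) : ℤ) = (l.down : ℤ) + k := by push_cast; lia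
    generalize y (l.down + k) = y'
    change T ⟶ (J l).X _ at y'
    revert y'
    rw [h1, h2]
    exact fun y' => ⟨y', fun _ => rfl, fun T' π w h => ⟨w, h⟩⟩
  choose z hz hz' using hz
  obtain ⟨T₂, π₂, _, w, hw⟩ := hk.exists_family_lift J (fun l => l.down)
    (fun l n => hI _ n) (fun l t => hex _ _ (by push_cast; lia)) (fun l => π₁ ≫ z l) (fun l => by
      rw [Category.assoc, hz]
      by_cases hc : ((l.down + k : ℕ) : ℤ) + 2 = (l.down : ℤ) + (k + 2 : ℕ)
      · rw [← hc, hy, comp_zero]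
      · exact (hc (by push_cast; lia)).elim)
  have key (j : ℕ) : ∃ w : T₂ ⟶ (I j).X j, (π₂ ≫ π₁) ≫ y j = w ≫ (I j).d j (j + 1) := by
    by_cases hj : j < k
    · obtain ⟨w', hw'⟩ := h₁ j hj
      exact ⟨π₂ ≫ w', by rw [Category.assoc, hw', Category.assoc]⟩
    · obtain ⟨l, rfl⟩ := Nat.exists_eq_add_of_le' (not_lt.1 hj)
      exact hz' ⟨l⟩ T₂ (π₂ ≫ π₁) (w ⟨l⟩) (by rw [Category.assoc]; exact hw ⟨l⟩)
  choose w' hw' using key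
  exact ⟨T₂, π₂ ≫ π₁, inferInstance, w', hw'⟩

/-! ### Cocycles of Cartan-Eilenberg resolutions -/

section

open HomologicalComplex

namespace Bicomplex

theorem exists_lift_cycles_X (L : CochainComplex (CochainComplex C ℤ) ℤ) (m m' i : ℤ)
    (hm : m + 1 = m') {T : C} (x : T ⟶ (L.X m).X i) (hx : x ≫ (L.d m m').f i = 0) :
    ∃ z : T ⟶ (L.cycles m).X i, z ≫ (L.iCycles m).f i = x := by
  have hex : (ShortComplex.mk (L.iCycles m) (L.d m m') (by simp)).Exact :=
    ShortComplex.exact_of_f_is_kernel _ (L.cyclesIsKernel m m' (by simpa using hm))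
  have hex' := hex.map (HomologicalComplex.eval C _ i)
  have : Mono ((ShortComplex.mk (L.iCycles m) (L.d m m') (by simp)).map
    (HomologicalComplex.eval C _ i)).f := inferInstanceAs (Mono ((L.iCycles m).f i))
  exact ⟨hex'.lift x hx, hex'.lift_f x hx⟩

section Stalk
variable (A : CochainComplex C ℤ)

/-- The isomorphism between the term in degree `0` of the `m`-th column of `stalkDouble A` and
`A^m`. -/
abbrev stalkIso (m : ℤ) : ((stalkDouble A).X m).X 0 ≅ A.X m :=
  singleObjXSelf (ComplexShape.up ℤ) 0 (A.X m)

theorem stalkDouble_d_f_zero (m m' : ℤ) :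
    ((stalkDouble A).d m m').f 0 ≫ (stalkIso A m').hom = (stalkIso A m).hom ≫ A.d m m' := by
  change ((HomologicalComplex.single C (ComplexShape.up ℤ) 0).map (A.d m m')).f 0 ≫
    (singleObjXSelf (ComplexShape.up ℤ) 0 (A.X m')).hom = _
  rw [single_map_f_self, Category.assoc, Category.assoc, Iso.inv_hom_id, Category.comp_id]
  rfl

theorem isZero_stalkDouble_X (m i : ℤ) (hi : i ≠ 0) : IsZero (((stalkDouble A).X m).X i) :=
  isZero_single_obj_X (ComplexShape.up ℤ) 0 (A.X m) i hi

theorem isZero_cycles_stalkDouble_X (m i : ℤ) (hi : i ≠ 0) :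
    IsZero (((stalkDouble A).cycles m).X i) :=
  IsZero.of_mono (((stalkDouble A).iCycles m).f i) (isZero_stalkDouble_X A m i hi)

end Stalk

theorem augDouble_f_f_zero {K : Bicomplex C} {A : CochainComplex C ℤ} (lam : A ⟶ K.row 0)
    (hlam : ∀ m, lam.f m ≫ K.d₁ 0 1 m = 0) (m : ℤ) :
    ((augDouble lam hlam).f m).f 0 = (stalkIso A m).hom ≫ lam.f m := by
  change (augColumn lam hlam m).f 0 = _
  rw [augColumn, mkHomFromSingle_f]
  rfl

end Bicomplex

theorem quasiIso_of_iso_inv_comp {L L' M : CochainComplex C ℤ} (e : L ≅ L') (f : L ⟶ M)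
    (h : QuasiIso (e.inv ≫ f)) : QuasiIso f :=
  (quasiIso_iff_comp_left e.inv f).1 h

namespace IsInjectiveResolution

theorem exactAt {B : C} {I : CochainComplex C ℤ}
    {f : (HomologicalComplex.single C (ComplexShape.up ℤ) 0).obj B ⟶ I}
    (h : IsInjectiveResolution f) (n : ℤ) (hn : n ≠ 0) : I.ExactAt n := by
  have := h.quasiIso
  exact (exactAt_iff_of_quasiIsoAt f n).1 (exactAt_single_obj _ _ _ _ hn)

end IsInjectiveResolution

namespace IsCEResolution
open Bicomplex

variable {A : CochainComplex C ℤ} {K : Bicomplex C} {lam : A ⟶ K.row 0}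
  (h : IsCEResolution K lam)
include h

theorem exactAt_cycles (m n : ℤ) (hn : n ≠ 0) : (K.toDouble.cycles m).ExactAt n :=
  (cyclesShortComplex_shortExact K.toDouble m).exactAt_X₂ n ((h.coboundaries m).exactAt n hn)
    ((h.homology m).exactAt n hn)

theorem injective_cycles_X (m n : ℤ) : Injective ((K.toDouble.cycles m).X n) :=
  injective_X₂_of_shortExact ((cyclesShortComplex_shortExact K.toDouble m).map_of_exact
    (HomologicalComplex.eval C _ n)) ((h.coboundaries m).injective n) ((h.homology m).injective n)

theorem injective_row_cycles (n m : ℤ) : Injective ((K.row n).cycles m) :=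
  Injective.of_iso ((K.toDouble.sc m).mapCyclesIso (HomologicalComplex.eval C _ n)).symm
    (h.injective_cycles_X m n)

theorem quasiIso_coboundariesMap (m : ℤ) :
    QuasiIso (coboundariesMap (augDouble lam h.aug_d₁) m) := by
  exact quasiIso_of_iso_inv_comp _ _ (h.coboundaries m).quasiIso

theorem quasiIso_homologyMap (m : ℤ) :
    QuasiIso (homologyMap (augDouble lam h.aug_d₁) m) := by
  exact quasiIso_of_iso_inv_comp _ _ (h.homology m).quasiIso

theorem quasiIso_cyclesMap (m : ℤ) : QuasiIso (cyclesMap (augDouble lam h.aug_d₁) m) :=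
  quasiIso_τ₂ (cyclesShortComplexMap (augDouble lam h.aug_d₁) m)
    (cyclesShortComplex_shortExact _ m) (cyclesShortComplex_shortExact _ m)
    (h.quasiIso_coboundariesMap m) (h.quasiIso_homologyMap m)

/-- The map `B^m(A) ⟶ B^m(C₀)^0` is onto the vertical cocycles (up to refinements). -/
theorem exists_coboundary_lift (m₀ m : ℤ) (hm : m₀ + 1 = m) {T : C}
    (x : T ⟶ K.X 0 m₀) (hx : x ≫ K.d₀ 0 m₀ m ≫ K.d₁ 0 1 m = 0) :
    ∃ (T' : C) (π : T' ⟶ T) (_ : Epi π) (b : T' ⟶ A.X m₀),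
      π ≫ x ≫ K.d₀ 0 m₀ m = b ≫ A.d m₀ m ≫ lam.f m := by
  obtain rfl : m₀ = m - 1 := by lia
  let φ := augDouble lam h.aug_d₁
  have := h.quasiIso_coboundariesMap m
  have hE := (epi_homologyMap_iff_up_to_refinements (coboundariesMap φ m) (-1) 0 1
    (by simp) (by simp)).1 inferInstance
  let p := factorThruImage (K.toDouble.d (m - 1) m)
  let i := image.ι (K.toDouble.d (m - 1) m)
  have hpi : p.f 0 ≫ i.f 0 = K.d₀ 0 (m - 1) m := by
    rw [← comp_f, image.fac]
  obtain ⟨T₁, π₁, _, b₁, -, y, hb₁⟩ := hE (x ≫ p.f 0) (by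
    rw [← cancel_mono (i.f 1)]
    have h1 : (Bicomplex.coboundaries K.toDouble m).d 0 1 ≫ i.f 1 =
      i.f 0 ≫ (m.negOnePow • K.d₁ 0 1 m) := (i.comm 0 1).symm
    rw [zero_comp, Category.assoc, Category.assoc, h1, reassoc_of% hpi,
      Linear.comp_units_smul, Linear.comp_units_smul, hx, smul_zero])
  rw [((h.coboundaries m).isZero (-1) (by lia)).eq_of_tgt y 0, zero_comp, add_zero] at hb₁
  obtain ⟨T₂, π₂, _, b₂, hb₂⟩ := surjective_up_to_refinements_of_epi
    ((factorThruImage ((stalkDouble A).d (m - 1) m)).f 0) b₁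
  refine ⟨T₂, π₂ ≫ π₁, inferInstance, b₂ ≫ (stalkIso A (m - 1)).hom, ?_⟩
  have h2 : (coboundariesMap φ m).f 0 ≫ i.f 0 =
      (image.ι ((stalkDouble A).d (m - 1) m)).f 0 ≫ (φ.f m).f 0 := by
    have : coboundariesMap φ m ≫ i = image.ι ((stalkDouble A).d (m - 1) m) ≫ φ.f m :=
      image.map_homMk'_ι _
    rw [← comp_f, ← comp_f, this]
  have h3 : (factorThruImage ((stalkDouble A).d (m - 1) m)).f 0 ≫
      (image.ι ((stalkDouble A).d (m - 1) m)).f 0 = ((stalkDouble A).d (m - 1) m).f 0 := by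
    rw [← comp_f, image.fac]
  have h4 : (φ.f m).f 0 = (stalkIso A m).hom ≫ lam.f m := augDouble_f_f_zero _ _ _
  rw [← hpi, Category.assoc, Category.assoc, ← reassoc_of% stalkDouble_d_f_zero, ← h4,
    ← h3, Category.assoc, ← h2, ← reassoc_of% hb₂, ← reassoc_of% hb₁]

/-- The map `Z^m(A) ⟶ Z^m(C₀)^0` is onto the vertical cocycles (up to refinements). -/
theorem exists_cycle_lift (m m' : ℤ) (hm : m + 1 = m') {T : C}
    (x : T ⟶ K.X 0 m) (hx₀ : x ≫ K.d₀ 0 m m' = 0) (hx₁ : x ≫ K.d₁ 0 1 m = 0) :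
    ∃ (T' : C) (π : T' ⟶ T) (_ : Epi π) (e : T' ⟶ A.X m),
      e ≫ A.d m m' = 0 ∧ π ≫ x = e ≫ lam.f m := by
  let φ := augDouble lam h.aug_d₁
  have := h.quasiIso_cyclesMap m
  have hE := (epi_homologyMap_iff_up_to_refinements (cyclesMap φ m) (-1) 0 1
    (by simp) (by simp)).1 inferInstance
  let i := K.toDouble.iCycles m
  obtain ⟨z, hz⟩ : ∃ z : T ⟶ (K.toDouble.cycles m).X 0, z ≫ i.f 0 = x :=
    exists_lift_cycles_X K.toDouble m m' 0 hm x hx₀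
  obtain ⟨T₁, π₁, _, e, -, y, he⟩ := hE z (by
    rw [← cancel_mono (i.f 1)]
    have h1 : (K.toDouble.cycles m).d 0 1 ≫ i.f 1 =
      i.f 0 ≫ (m.negOnePow • K.d₁ 0 1 m) := (i.comm 0 1).symm
    rw [zero_comp, Category.assoc, h1, reassoc_of% hz,
      Linear.comp_units_smul, hx₁, smul_zero])
  have hy : y ≫ (K.toDouble.cycles m).d (-1) 0 = 0 := by
    rw [(IsZero.of_mono (i.f (-1)) (h.lowerHalfPlane (-1) m (by lia))).eq_of_tgt y 0, zero_comp]
  rw [hy, add_zero] at he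
  refine ⟨T₁, π₁, inferInstance, e ≫ ((stalkDouble A).iCycles m).f 0 ≫ (stalkIso A m).hom, ?_, ?_⟩
  · rw [Category.assoc, Category.assoc, ← stalkDouble_d_f_zero, ← comp_f_assoc, iCycles_d,
      zero_f, zero_comp, comp_zero]
  · have h2 : (cyclesMap φ m).f 0 ≫ i.f 0 = ((stalkDouble A).iCycles m).f 0 ≫ (φ.f m).f 0 := by
      rw [← comp_f, ← comp_f, cyclesMap_i]
    have h4 : (φ.f m).f 0 = (stalkIso A m).hom ≫ lam.f m := augDouble_f_f_zero _ _ _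
    rw [← hz, reassoc_of% he, h2, h4, Category.assoc, Category.assoc]

/-- The map `Z^m(A) ⟶ Z^m(C₀)^0` is a monomorphism. -/
theorem eq_zero_of_comp_eq_zero (m m' : ℤ) (hm : m + 1 = m') {T : C} (a : T ⟶ A.X m)
    (ha : a ≫ A.d m m' = 0) (ha' : a ≫ lam.f m = 0) : a = 0 := by
  let φ := augDouble lam h.aug_d₁
  have := h.quasiIso_cyclesMap m
  have hE := (mono_homologyMap_iff_up_to_refinements (cyclesMap φ m) (-1) 0 1
    (by simp) (by simp)).1 inferInstance
  obtain ⟨z, hz⟩ := exists_lift_cycles_X (stalkDouble A) m m' 0 hm (a ≫ (stalkIso A m).inv) (by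
    rw [← cancel_mono (stalkIso A m').hom, Category.assoc, stalkDouble_d_f_zero]
    simp [ha])
  obtain ⟨T', π, _, y, hy⟩ := hE z
    ((isZero_cycles_stalkDouble_X A m 1 (by lia)).eq_of_tgt _ _) 0 (by
      rw [zero_comp, ← cancel_mono ((K.toDouble.iCycles m).f 0), zero_comp, Category.assoc,
        ← comp_f, cyclesMap_i, comp_f, reassoc_of% hz, augDouble_f_f_zero]
      simp [ha'])
  rw [(isZero_cycles_stalkDouble_X A m (-1) (by lia)).eq_of_tgt y 0, zero_comp] at hy
  have hz0 : z = 0 := by rw [← cancel_epi π, hy, comp_zero]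
  rw [← cancel_mono (stalkIso A m).inv, ← hz, hz0, zero_comp, zero_comp]

end IsCEResolution

/-! ### Exactness of the totalization of the augmented bicomplex -/

namespace Bicomplex

/-- Let `F_q` be subcomplexes of the columns of a bicomplex, degreewise injective and exact in nonzero
degrees. Then any family of vertical cocycles of `F_q`, in positive vertical degrees and of total
degree `n`, is the vertical coboundary of a family in the `F_q`, after a common refinement. -/
theorem exists_d₁_lift [HasLimits C] [EnoughInjectives C] {k : ℕ} (hk : AbFourStar C k)
    {K : Bicomplex C} (F : ℤ → CochainComplex C ℤ) (ι : ∀ q, F q ⟶ K.column q)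
    (hι : ∀ q, Mono (ι q)) (hinj : ∀ q n, Injective ((F q).X n))
    (hex : ∀ q (n : ℤ), n ≠ 0 → (F q).ExactAt n) (n : ℤ) {T : C}
    (y : ∀ i q : ℤ, i + q = n → (T ⟶ (F q).X i))
    (hy : ∀ (i i' q : ℤ) (h : i + q = n), 0 < i → i + 1 = i' →
      y i q h ≫ (ι q).f i ≫ K.d₁ i i' q = 0) :
    ∃ (T' : C) (π : T' ⟶ T) (_ : Epi π)
      (w : ∀ i q : ℤ, 0 ≤ i → i + q + 1 = n → (T' ⟶ (F q).X i)),
      ∀ (i i' q : ℤ) (hi : 0 ≤ i) (h : i + q + 1 = n) (hi' : i + 1 = i'),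
        π ≫ y i' q (by lia) ≫ (ι q).f i' = w i q hi h ≫ (ι q).f i ≫ K.d₁ i i' q := by
  have hd (q i i') : (F q).d i i' ≫ (ι q).f i' = (ι q).f i ≫ (q.negOnePow • K.d₁ i i' q) :=
    ((ι q).comm i i').symm
  obtain ⟨T', π, _, w, hw⟩ := hk.exists_lift (fun j => F (n - 1 - j)) (fun j m => hinj _ m)
    (fun j m hm => hex _ m hm.ne') (fun j => y (j + 1) (n - 1 - j) (by lia)) (fun j => by
      rw [← cancel_mono ((ι (n - 1 - j)).f (j + 2)), zero_comp, Category.assoc, hd,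
        Linear.comp_units_smul, Linear.comp_units_smul, hy _ _ _ _ (by lia) (by lia), smul_zero])
  have key (i q : ℤ) (hi : 0 ≤ i) (h : i + q + 1 = n) : ∃ v : T' ⟶ (F q).X i,
      ∀ (i' : ℤ) (hi' : i + 1 = i'),
        π ≫ y i' q (by lia) ≫ (ι q).f i' = v ≫ (ι q).f i ≫ K.d₁ i i' q := by
    lift i to ℕ using hi
    obtain rfl : q = n - 1 - i := by lia
    -- the differential of the columns is `(-1)^q d₁`
    refine ⟨(n - 1 - i).negOnePow • w i, ?_⟩
    rintro i' rfl
    rw [reassoc_of% hw i, hd, Linear.comp_units_smul, Linear.comp_units_smul,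
      Linear.units_smul_comp]
  choose v hv using key
  exact ⟨T', π, inferInstance, v, fun i i' q hi h hi' => hv i q hi h i' hi'⟩

end Bicomplex

namespace IsCEResolution
open Bicomplex

variable [HasLimits C] [EnoughInjectives C] {k : ℕ}
  {A : CochainComplex C ℤ} {K : Bicomplex C} {lam : A ⟶ K.row 0}

/-- The case of the columns `B` of `exists_d₁_lift`, where moreover the family of coboundaries which
is obtained is lifted along the (split) horizontal differential. -/
theorem exists_coboundary_d₁_lift (h : IsCEResolution K lam) (hk : AbFourStar C k)
    (n : ℤ) {T : C} (x : ∀ i q : ℤ, i + q = n → (T ⟶ K.X i q))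
    (hx : ∀ (i i' q q' : ℤ) (h : i + q = n), 0 < i → i + 1 = i' → q + 1 = q' →
      x i q h ≫ K.d₀ i q q' ≫ K.d₁ i i' q' = 0) :
    ∃ (T' : C) (π : T' ⟶ T) (_ : Epi π)
      (u : ∀ i q : ℤ, 0 ≤ i → i + q + 1 = n → (T' ⟶ K.X i q)),
      ∀ (i i' q₀ q : ℤ) (hi : 0 ≤ i) (h : i' + q₀ = n) (hi' : i + 1 = i'), q₀ + 1 = q →
        π ≫ x i' q₀ h ≫ K.d₀ i' q₀ q =
          u i q₀ hi (by lia) ≫ K.d₀ i q₀ q ≫ K.d₁ i i' q := by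
  let p (q : ℤ) := factorThruImage (K.toDouble.d (q - 1) q)
  let ι (q : ℤ) := image.ι (K.toDouble.d (q - 1) q)
  have hpι (q i : ℤ) : (p q).f i ≫ (ι q).f i = K.d₀ i (q - 1) q := by
    rw [← comp_f, image.fac]
  obtain ⟨T', π, _, w, hw⟩ := exists_d₁_lift hk (fun q => Bicomplex.coboundaries K.toDouble q) ι
    (fun q => inferInstance) (fun q m => (h.coboundaries q).injective m)
    (fun q m hm => (h.coboundaries q).exactAt m hm) (n + 1)
    (fun i q hiq => x i (q - 1) (by lia) ≫ (p q).f i) (fun i i' q hiq hi hi' => by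
      rw [Category.assoc, reassoc_of% hpι, hx i i' _ _ _ hi hi' (by lia)])
  choose t ht using fun i => exists_comp_comp_d_eq (K.row i) (h.injective i)
    (h.injective_row_cycles i)
  have hι (i q : ℤ) : (ι q).f i ≫ t i (q - 1) q ≫ K.d₀ i (q - 1) q = (ι q).f i := by
    rw [← cancel_epi ((p q).f i), reassoc_of% hpι, hpι]
    exact ht i (q - 1) q
  refine ⟨T', π, inferInstance, fun i q hi hiq => w i (q + 1) hi (by lia) ≫
    (ι (q + 1)).f i ≫ t i q (q + 1), ?_⟩
  intro i i' q₀ q hi hiq hi' hq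
  obtain rfl : q₀ = q - 1 := by lia
  have h1 := hw i i' q hi (by lia) hi'
  rw [Category.assoc, hpι] at h1
  rw [h1]
  have h2 : q - 1 + 1 = q := by lia
  have key (q' : ℤ) (hq' : q' = q) : w i q hi (by lia) ≫ (ι q).f i ≫ K.d₁ i i' q =
      (w i q' hi (by lia) ≫ (ι q').f i ≫ t i (q - 1) q') ≫ K.d₀ i (q - 1) q ≫ K.d₁ i i' q := by
    subst hq'
    simp only [Category.assoc]
    rw [reassoc_of% hι]
  exact key _ h2

/-- The case of the columns `Z` of `exists_d₁_lift`. -/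
theorem exists_cycle_d₁_lift (h : IsCEResolution K lam) (hk : AbFourStar C k)
    (n : ℤ) {T : C} (x : ∀ i q : ℤ, 0 < i → i + q = n → (T ⟶ K.X i q))
    (hx₀ : ∀ (i q q' : ℤ) (hi : 0 < i) (h : i + q = n), q + 1 = q' →
      x i q hi h ≫ K.d₀ i q q' = 0)
    (hx₁ : ∀ (i i' q : ℤ) (hi : 0 < i) (h : i + q = n), i + 1 = i' →
      x i q hi h ≫ K.d₁ i i' q = 0) :
    ∃ (T' : C) (π : T' ⟶ T) (_ : Epi π)
      (z : ∀ i q : ℤ, 0 ≤ i → i + q + 1 = n → (T' ⟶ K.X i q)),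
      (∀ (i q q' : ℤ) (hi : 0 ≤ i) (h : i + q + 1 = n), q + 1 = q' →
        z i q hi h ≫ K.d₀ i q q' = 0) ∧
      ∀ (i i' q : ℤ) (hi : 0 ≤ i) (h : i + q + 1 = n) (hi' : i + 1 = i'),
        π ≫ x i' q (by lia) (by lia) = z i q hi h ≫ K.d₁ i i' q := by
  have key (i q : ℤ) (hiq : i + q = n) : ∃ y : T ⟶ (K.toDouble.cycles q).X i,
      ∀ hi : 0 < i, y ≫ (K.toDouble.iCycles q).f i = x i q hi hiq := by
    by_cases hi : 0 < i
    · obtain ⟨y, hy⟩ := exists_lift_cycles_X K.toDouble q (q + 1) i rfl (x i q hi hiq)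
        (hx₀ i q (q + 1) hi hiq rfl)
      exact ⟨y, fun _ => hy⟩
    · exact ⟨0, fun hi' => (hi hi').elim⟩
  choose y hy using key
  obtain ⟨T', π, _, w, hw⟩ := exists_d₁_lift hk (fun q => K.toDouble.cycles q)
    (fun q => K.toDouble.iCycles q) (fun q => inferInstance) (fun q m => h.injective_cycles_X q m)
    (fun q m hm => h.exactAt_cycles q m hm) n y (fun i i' q hiq hi hi' => by
      rw [reassoc_of% hy i q hiq hi, hx₁ i i' q hi hiq hi'])
  refine ⟨T', π, inferInstance, fun i q hi hiq => w i q hi hiq ≫ (K.toDouble.iCycles q).f i,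
    ?_, ?_⟩
  · intro i q q' hi hiq hq
    have : (K.toDouble.iCycles q).f i ≫ K.d₀ i q q' = 0 := by
      change (K.toDouble.iCycles q).f i ≫ (K.toDouble.d q q').f i = 0
      rw [← comp_f, iCycles_d, zero_f]
    rw [Category.assoc, this, comp_zero]
  · intro i i' q hi hiq hi'
    rw [← hy i' q (by lia) (by lia), hw i i' q hi hiq hi', Category.assoc]

/-- The totalization of the bicomplex `K`, augmented by `A` in the row `-1`, is exact: a cocycle
`(a, x)` is the coboundary of some `(c, u)`, up to refinements. -/
theorem exists_tot_lift (h : IsCEResolution K lam) (hk : AbFourStar C k)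
    (n₀ n n' n'' : ℤ) (hn₀ : n₀ + 1 = n) (hn' : n + 1 = n') (hn'' : n' + 1 = n'') {T : C}
    (a : T ⟶ A.X n') (x : ∀ i q : ℤ, i + q = n → (T ⟶ K.X i q))
    (ha : a ≫ A.d n' n'' = 0)
    (hax : a ≫ lam.f n' = x 0 n (zero_add n) ≫ K.d₀ 0 n n')
    (hx : ∀ (i i' q q' : ℤ) (hi' : i + 1 = i') (hq : q + 1 = q') (hiq : i' + q = n), 0 ≤ i →
      x i' q hiq ≫ K.d₀ i' q q' + x i q' (by lia) ≫ K.d₁ i i' q' = 0) :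
    ∃ (T' : C) (π : T' ⟶ T) (_ : Epi π) (c : T' ⟶ A.X n)
      (u : ∀ i q : ℤ, i + q + 1 = n → (T' ⟶ K.X i q)),
      π ≫ a = c ≫ A.d n n' ∧
      π ≫ x 0 n (zero_add n) = c ≫ lam.f n + u 0 n₀ (by lia) ≫ K.d₀ 0 n₀ n ∧
      ∀ (i i' q₀ q : ℤ) (hi' : i + 1 = i') (hq : q₀ + 1 = q) (hiq : i' + q = n), 0 ≤ i →
        π ≫ x i' q hiq = u i' q₀ (by lia) ≫ K.d₀ i' q₀ q + u i q (by lia) ≫ K.d₁ i i' q := by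
  have hd (i i' q q' : ℤ) : K.d₀ i q q' ≫ K.d₁ i i' q' = - (K.d₁ i i' q ≫ K.d₀ i' q q') :=
    eq_neg_of_add_eq_zero_left (K.anticomm i i' q q')
  have hx' (i i' q q' : ℤ) (hiq : i + q = n) (hi : 0 ≤ i) (hi' : i + 1 = i') (hq : q + 1 = q') :
      x i q hiq ≫ K.d₀ i q q' ≫ K.d₁ i i' q' = 0 := by
    have := hx i i' (q - 1) q hi' (by lia) (by lia) hi =≫ K.d₀ i' q q'
    simp only [Preadditive.add_comp, Category.assoc, K.d₀_comp_d₀, comp_zero, zero_add,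
      zero_comp] at this
    rw [hd, Preadditive.comp_neg, this, neg_zero]
  -- the vertical cocycles `x i q ≫ d₀` lie in the columns `B`
  obtain ⟨T₁, π₁, _, b, hb⟩ := h.exists_coboundary_lift n n' hn' (x 0 n (zero_add n))
    (hx' 0 1 n n' (zero_add n) le_rfl (by lia) hn')
  obtain ⟨T₂, π₂, _, u, hu⟩ := h.exists_coboundary_d₁_lift hk n
    (fun i q hiq => π₁ ≫ x i q hiq) (fun i i' q q' hiq hi hi' hq => by
      rw [Category.assoc, hx' i i' q q' hiq hi.le hi' hq, comp_zero])
  -- `x₀` and `x'` are the components of a cocycle which differs from `x` by a coboundary, and for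
  -- which the horizontal differential vanishes
  let r : T₂ ⟶ T := π₂ ≫ π₁
  have hr : Epi r := inferInstanceAs (Epi (π₂ ≫ π₁))
  let x₀ : T₂ ⟶ K.X 0 n :=
    r ≫ x 0 n (zero_add n) - (π₂ ≫ b) ≫ lam.f n + u 0 n₀ le_rfl (by lia) ≫ K.d₀ 0 n₀ n
  let x' (i q : ℤ) (hi : 0 < i) (hiq : i + q = n) : T₂ ⟶ K.X i q :=
    r ≫ x i q hiq + u i (q - 1) hi.le (by lia) ≫ K.d₀ i (q - 1) q +
      u (i - 1) q (by lia) (by lia) ≫ K.d₁ (i - 1) i q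
  have hrd (i i' q₀ q : ℤ) (hi : 0 ≤ i) (hiq : i + q = n) (hi' : i + 1 = i') (hq : q₀ + 1 = q) :
      r ≫ x i q hiq ≫ K.d₁ i i' q =
        -(u i q₀ hi (by lia) ≫ K.d₀ i q₀ q ≫ K.d₁ i i' q) := by
    rw [← hu i i' q₀ q hi (by lia) hi' hq,
      eq_neg_of_add_eq_zero_right (hx i i' q₀ q hi' hq (by lia) hi), Preadditive.comp_neg]
    simp only [r, Category.assoc]
  have hx₀d₀ : x₀ ≫ K.d₀ 0 n n' = 0 := by
    have h1 : lam.f n ≫ K.d₀ 0 n n' = A.d n n' ≫ lam.f n' := lam.comm n n'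
    simp only [x₀, r, Preadditive.add_comp, Preadditive.sub_comp, Category.assoc, hb,
      K.d₀_comp_d₀, comp_zero, add_zero, h1, sub_self]
  have hx₀d₁ : x₀ ≫ K.d₁ 0 1 n = 0 := by
    simp only [x₀, Preadditive.add_comp, Preadditive.sub_comp, Category.assoc, h.aug_d₁,
      comp_zero, sub_zero, hrd 0 1 n₀ n le_rfl (by lia) (by lia) hn₀, neg_add_cancel]
  obtain ⟨T₃, π₃, _, e, he, he'⟩ := h.exists_cycle_lift n n' hn' x₀ hx₀d₀ hx₀d₁
  obtain ⟨T₄, π₄, _, z, hz, hz'⟩ := h.exists_cycle_d₁_lift hk n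
    (fun i q hi hiq => π₃ ≫ x' i q hi hiq) (fun i q q' hi hiq hq => by
      have h1 := hu (i - 1) i q q' (by lia) hiq (by lia) hq
      rw [hd, Preadditive.comp_neg, Category.assoc] at h1
      simp only [x', r, Category.assoc, Preadditive.add_comp, K.d₀_comp_d₀, comp_zero, add_zero, h1,
        neg_add_cancel]) (fun i i' q hi hiq hi' => by
      simp only [x', Category.assoc, Preadditive.add_comp, K.d₁_comp_d₁, comp_zero, add_zero,
        hrd i i' (q - 1) q hi.le hiq hi' (by lia), neg_add_cancel])
  -- the values of `v` in the rows of negative index do not matter, as these rows vanish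
  let c : T₄ ⟶ A.X n := π₄ ≫ (π₃ ≫ π₂ ≫ b + e)
  let v (i q : ℤ) (hiq : i + q + 1 = n) : T₄ ⟶ K.X i q :=
    if hi : 0 ≤ i then z i q hi hiq - π₄ ≫ π₃ ≫ u i q hi hiq else 0
  have hv (i q : ℤ) (hi : 0 ≤ i) (hiq : i + q + 1 = n) :
      v i q hiq = z i q hi hiq - π₄ ≫ π₃ ≫ u i q hi hiq := dif_pos hi
  have hπ : Epi (π₄ ≫ π₃ ≫ r) := inferInstance
  have hc : (π₄ ≫ π₃ ≫ r) ≫ x 0 n (zero_add n) =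
      c ≫ lam.f n + v 0 n₀ (by lia) ≫ K.d₀ 0 n₀ n := by
    have h1 : r ≫ x 0 n (zero_add n) = x₀ + π₂ ≫ b ≫ lam.f n -
        u 0 n₀ le_rfl (by lia) ≫ K.d₀ 0 n₀ n := by
      simp only [x₀, Category.assoc]
      abel
    rw [hv 0 n₀ le_rfl, Preadditive.sub_comp, hz 0 n₀ n le_rfl (by lia) hn₀, Category.assoc,
      Category.assoc, h1]
    simp only [c, Preadditive.comp_add, Preadditive.comp_sub, Preadditive.add_comp, he',
      Category.assoc]
    abel
  clear_value c
  refine ⟨T₄, π₄ ≫ π₃ ≫ r, hπ, c, v, ?_, hc, ?_⟩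
  · rw [← sub_eq_zero]
    apply h.eq_zero_of_comp_eq_zero n' n'' hn''
    · simp only [Preadditive.sub_comp, Category.assoc, ha, A.d_comp_d, comp_zero, sub_zero]
    · have h1 : lam.f n ≫ K.d₀ 0 n n' = A.d n n' ≫ lam.f n' := lam.comm n n'
      have h2 := hc =≫ K.d₀ 0 n n'
      rw [Preadditive.add_comp, Category.assoc, Category.assoc _ _ (K.d₀ 0 n n'),
        Category.assoc _ _ (K.d₀ 0 n n'), h1, K.d₀_comp_d₀, comp_zero, add_zero] at h2
      rw [Preadditive.sub_comp, Category.assoc, hax, h2, Category.assoc, sub_self]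
  · intro i i' q₀ q hi' hq hiq hi
    have h1 := hz' i i' q hi (by lia) hi'
    obtain rfl : i = i' - 1 := by lia
    obtain rfl : q₀ = q - 1 := by lia
    rw [hv i' _ (by lia), hv _ q hi, Preadditive.sub_comp, Preadditive.sub_comp,
      hz i' (q - 1) q (by lia) (by lia) (by lia), ← h1]
    simp only [x', Preadditive.comp_add, Category.assoc]
    abel

theorem quasiIso_augTot (h : IsCEResolution K lam) (hk : AbFourStar C k) :
    QuasiIso (augTot lam h.aug_d₁) := by
  have haug (n i j : ℤ) (hij : i + j = n) :
      (augTot lam h.aug_d₁).f n ≫ K.totProj n i j hij = augComponent lam n i j hij :=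
    K.totLift_totπ _ _ _ _ _
  rw [quasiIso_iff]
  intro n
  rw [quasiIsoAt_iff_isIso_homologyMap]
  have : Mono (homologyMap (augTot lam h.aug_d₁) n) := by
    rw [mono_homologyMap_iff_up_to_refinements _ (n - 1) n (n + 1) (by simp) (by simp)]
    intro T a ha y hy
    obtain ⟨T', π, hπ, c, -, hc, -⟩ := h.exists_tot_lift hk (n - 2) (n - 1) n (n + 1) (by lia)
      (by lia) rfl a (fun i q hiq => y ≫ K.totProj (n - 1) i q hiq) ha (by
        have := hy =≫ K.totProj n 0 n (zero_add n)
        rw [Category.assoc, haug, augComponent_zero, Category.assoc,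
          K.tot_d_totProj (n - 1) n 0 (-1) n (n - 1) (by lia) (by lia) (by lia),
          (h.lowerHalfPlane (-1) n (by lia)).eq_of_tgt (K.totProj (n - 1) (-1) n _) 0, zero_comp,
          add_zero] at this
        rw [this, Category.assoc]) (by
        intro i i' q q' hi' hq hiq hi
        have := hy =≫ K.totProj n i' q' (by lia)
        rw [Category.assoc, haug, augComponent_of_ne _ _ _ _ _ (by lia), comp_zero,
          Category.assoc, K.tot_d_totProj (n - 1) n i' i q' q (by lia) hi' hq,
          Preadditive.comp_add] at this
        rw [Category.assoc, Category.assoc, ← this])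
    exact ⟨T', π, hπ, c, hc⟩
  have : Epi (homologyMap (augTot lam h.aug_d₁) n) := by
    rw [epi_homologyMap_iff_up_to_refinements _ (n - 1) n (n + 1) (by simp) (by simp)]
    intro T y hy
    obtain ⟨T', π, hπ, c, u, hc, hc₀, hcu⟩ := h.exists_tot_lift hk (n - 1) n (n + 1) (n + 2)
      (by lia) rfl (by lia) (0 : T ⟶ A.X (n + 1)) (fun i q hiq => y ≫ K.totProj n i q hiq)
      zero_comp (by
        have := hy =≫ K.totProj (n + 1) 0 (n + 1) (zero_add _)
        rw [Category.assoc, K.tot_d_totProj n (n + 1) 0 (-1) (n + 1) n (by lia) (by lia) (by lia),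
          (h.lowerHalfPlane (-1) (n + 1) (by lia)).eq_of_tgt (K.totProj n (-1) (n + 1) _) 0,
          zero_comp, add_zero, zero_comp] at this
        rw [zero_comp, Category.assoc, this]) (by
        intro i i' q q' hi' hq hiq hi
        have := hy =≫ K.totProj (n + 1) i' q' (by lia)
        rw [Category.assoc, K.tot_d_totProj n (n + 1) i' i q' q (by lia) hi' hq, zero_comp,
          Preadditive.comp_add] at this
        rw [Category.assoc, Category.assoc, this])
    refine ⟨T', π, hπ, c, by rw [← hc, comp_zero], K.totProdLift (n - 1) fun i q hiq =>
      u i q (by lia), ?_⟩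
    apply K.tot_hom_ext
    intro i q hiq
    rw [Preadditive.add_comp, Category.assoc, Category.assoc, Category.assoc, haug,
      K.tot_d_totProj (n - 1) n i (i - 1) q (q - 1) (by lia) (by lia) (by lia) hiq,
      Preadditive.comp_add, totProdLift_totProj_assoc, totProdLift_totProj_assoc]
    obtain hi | rfl | hi := lt_trichotomy i 0
    · exact (h.lowerHalfPlane i q hi).eq_of_tgt _ _
    · obtain rfl : q = n := by lia
      rw [hc₀, augComponent_zero,
        (h.lowerHalfPlane (0 - 1) q (by lia)).eq_of_tgt (u (0 - 1) q _) 0, zero_comp, add_zero]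
    · rw [augComponent_of_ne _ _ _ _ _ hi.ne', comp_zero, zero_add,
        hcu (i - 1) i (q - 1) q (by lia) (by lia) hiq (by lia)]
  exact isIso_of_mono_of_epi _

end IsCEResolution

end

end CartanEilenberg

end

theorem mainTheorem3 {C : Type u} [Category.{v} C] [Abelian C] [HasLimits C] [EnoughInjectives C]
    (k : ℕ) (hk : CartanEilenberg.AbFourStar C k)
    (A : CochainComplex C ℤ) (K : CartanEilenberg.Bicomplex C) (lam : A ⟶ K.row 0)
    (h : CartanEilenberg.IsCEResolution K lam) :
    CartanEilenberg.IsDGInjectiveResolution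
      (CartanEilenberg.Bicomplex.augTot lam h.aug_d₁) := by
  have := CartanEilenberg.Bicomplex.isKInjective_tot h.lowerHalfPlane h.injective
    h.injective_row_cycles
  exact ⟨h.quasiIso_augTot hk, CartanEilenberg.isDGInjective_of_isKInjective _
    (CartanEilenberg.Bicomplex.injective_tot_X h.injective)⟩
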